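/- **Setting.** A transfer matrix is a matrix of real rational functions of $z$; it is proper (strictly proper) if every entry is bounded (tends to $0$) as $z\to\infty$, and $\mathcal{RH}_\infty$ is the set of proper transfer matrices all of whose poles lie in $\{|z|<1\}$. Put $\|\mathbf G\|_\infty=\sup_{\theta}\sigma_{\max}(\mathbf G(e^{i\theta}))$ and $\|\mathbf G\|_{\mathcal H_2}=\big(\frac1{2\pi}\int_{-\pi}^{\pi}\|\mathbf G(e^{i\theta})\|_F^2\,d\theta\big)^{1/2}$ for $\mathbf G\in\mathcal{RH}_\infty$. Let $\hat{\mathbf G}\in\mathcal{RH}_\infty$ be $p\times m$, let $\epsilon>0$, and let $\mathcal D_\epsilon=\{\mathbf\Delta\in\mathcal{RH}_\infty:\|\mathbf\Delta\|_\infty<\epsilon\}$ ($p\times m$ matrices). Let $v_t\sim\mathcal N(0,I_p)$ and $w_t\sim\mathcal N(0,I_m)$, $t\ge 0$, be independent. For a proper plant $\mathbf G=\sum_k G_kz^{-k}$ and a proper $m\times p$ controller $\mathbf K=\sum_k K_kz^{-k}$, consider the loop $\mathbf y=\mathbf G\mathbf u+\mathbf v$, $\mathbf u=\mathbf K\mathbf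 y+\mathbf w$, i.e. $y_t=\sum_{k=0}^tG_ku_{t-k}+v_t$ and $u_t=\sum_{k=0}^tK_ky_{t-k}+w_t$. Its LQG cost is $$\mathcal J(\mathbf G,\mathbf K)=\lim_{T\to\infty}\mathbb E\Big[\frac1T\sum_{t=0}^T\big(y_t^{\mathsf T}y_t+u_t^{\mathsf T}u_t\big)\Big]\in[0,\infty]$$ if the loop is well posed (every $(v_t),(w_t)$ determines $(y_t),(u_t)$ uniquely), and $\mathcal J(\mathbf G,\mathbf K)=\infty$ otherwise. The closed-loop responses of $(\mathbf G,\mathbf K)$ are $\mathbf Y=(I-\mathbf G\mathbf K)^{-1}$, $\mathbf W=(I-\mathbf G\mathbf K)^{-1}\mathbf G$, $\mathbf U=\mathbf K(I-\mathbf G\mathbf K)^{-1}$, $\mathbf Z=(I-\mathbf K\mathbf G)^{-1}$; $\mathbf K$ internally stabilizes $\mathbf G$ if $I-\mathbf G\mathbf K$ is invertible and all four lie in $\mathcal{RH}_\infty$. The robust LQG problem is $$\inf_{\mathbf K\ \text{proper}}\ \sup_{\mathbf\Delta\in\mathcal D_\epsilon}\ \mathcal J(\hat{\mathbf G}+\mathbf\Delta,\mathbf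 K).\tag{1}$$ Let $\mathcal F$ be the set of all $(\hat{\mathbf Y},\hat{\mathbf W},\hat{\mathbf U},\hat{\mathbf Z})$ in $\mathcal{RH}_\infty$ with $$\begin{bmatrix}I&-\hat{\mathbf G}\end{bmatrix}\begin{bmatrix}\hat{\mathbf Y}&\hat{\mathbf W}\\\hat{\mathbf U}&\hat{\mathbf Z}\end{bmatrix}=\begin{bmatrix}I&0\end{bmatrix},\quad\begin{bmatrix}\hat{\mathbf Y}&\hat{\mathbf W}\\\hat{\mathbf U}&\hat{\mathbf Z}\end{bmatrix}\begin{bmatrix}-\hat{\mathbf G}\\I\end{bmatrix}=\begin{bmatrix}0\\I\end{bmatrix},\quad\|\hat{\mathbf U}\|_\infty\le\frac1\epsilon,$$ and such that $\hat{\mathbf Y}$ has a proper inverse. For $x=(\hat{\mathbf Y},\hat{\mathbf W},\hat{\mathbf U},\hat{\mathbf Z})\in\mathcal F$ put $\mathbf K_x=\hat{\mathbf U}\hat{\mathbf Y}^{-1}$ and $$\mathbf M_x(\mathbf\Delta)=\begin{bmatrix}\hat{\mathbf Y}(I-\mathbf\Delta\hat{\mathbf U})^{-1}&\hat{\mathbf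 Y}(I-\mathbf\Delta\hat{\mathbf U})^{-1}(\hat{\mathbf G}+\mathbf\Delta)\\\hat{\mathbf U}(I-\mathbf\Delta\hat{\mathbf U})^{-1}&(I-\hat{\mathbf U}\mathbf\Delta)^{-1}\hat{\mathbf Z}\end{bmatrix},$$ and consider the problem $$\inf_{x\in\mathcal F}\ \sup_{\mathbf\Delta\in\mathcal D_\epsilon}\ \|\mathbf M_x(\mathbf\Delta)\|_{\mathcal H_2}.\tag{2}$$ **Theorem.** Problems (1) and (2) are equivalent, in the following sense. 1. For every proper $\mathbf K$ and $\mathbf\Delta\in\mathcal D_\epsilon$ with well-posed loop, the limit defining $\mathcal J(\hat{\mathbf G}+\mathbf\Delta,\mathbf K)$ exists in $[0,\infty]$. For proper $\mathbf K$, the cost $\mathcal J(\hat{\mathbf G}+\mathbf\Delta,\mathbf K)$ is finite for every $\mathbf\Delta\in\mathcal D_\epsilon$ if and only if $\mathbf K$ internally stabilizes $\hat{\mathbf G}+\mathbf\Delta$ for every $\mathbf\Delta\in\mathcal D_\epsilon$. 2. $x\mapsto\mathbf K_x$ is a bijection from $\mathcal F$ onto the set of proper $\mathbf K$ with $\mathcal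 J(\hat{\mathbf G}+\mathbf\Delta,\mathbf K)<\infty$ for all $\mathbf\Delta\in\mathcal D_\epsilon$, and each $x\in\mathcal F$ consists of the closed-loop responses of $(\hat{\mathbf G},\mathbf K_x)$. 3. For $x\in\mathcal F$ and $\mathbf\Delta\in\mathcal D_\epsilon$, the matrices $I-\mathbf\Delta\hat{\mathbf U}$ and $I-\hat{\mathbf U}\mathbf\Delta$ are invertible, $\mathbf M_x(\mathbf\Delta)\in\mathcal{RH}_\infty$ is the block matrix $\begin{bmatrix}\mathbf Y&\mathbf W\\\mathbf U&\mathbf Z\end{bmatrix}$ of closed-loop responses of $(\hat{\mathbf G}+\mathbf\Delta,\mathbf K_x)$, and $\mathcal J(\hat{\mathbf G}+\mathbf\Delta,\mathbf K_x)=\|\mathbf M_x(\mathbf\Delta)\|_{\mathcal H_2}^2$. 4. The value of (1) is finite and equals the square of the value of (2). 5. $x\mapsto\mathbf K_x$ maps the set of minimizers of (2) bijectively onto the set of minimizers of (1); that is, the optimal robust controllers are exactly $\mathbf K=\hat{\mathbf U}\hat{\mathbf Y}^{-1}$ for optimal $(\hat{\mathbf Y},\hat{\mathbf W},\hat{\mathbf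 U},\hat{\mathbf Z})$. 6. If $\hat{\mathbf G}$ is strictly proper, then the requirement in $\mathcal F$ that $\hat{\mathbf Y}$ have a proper inverse follows from the other constraints. -/

import Mathlib

open scoped ENNReal

namespace RobustLQG

/-! ### Real-rational transfer matrices in the variable `z` -/

/-- Real-rational transfer matrices. -/
abbrev TransferMatrix (α β : Type) := Matrix α β (RatFunc ℝ)

/-- Every entry has numerator degree at most its denominator degree. -/
def IsProper {α β : Type} (G : TransferMatrix α β) : Prop :=
  ∀ i j, (G i j).num.degree ≤ (G i j).denom.degree

/-- Every entry vanishes at infinity. -/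
def IsStrictlyProper {α β : Type} (G : TransferMatrix α β) : Prop :=
  ∀ i j, (G i j).num.degree < (G i j).denom.degree

/-- The space `RH_∞` (discrete time): real-rational, proper, all poles in the open unit disc. -/
def IsRHinf {α β : Type} (G : TransferMatrix α β) : Prop :=
  IsProper G ∧ ∀ i j, ∀ z : ℂ, 1 ≤ ‖z‖ → Polynomial.aeval z (G i j).denom ≠ 0

/-- The frequency response `G(e^{iθ})`. -/
noncomputable def freqResponse {α β : Type} (G : TransferMatrix α β) (θ : ℝ) : Matrix α β ℂ :=
  G.map (RatFunc.eval (algebraMap ℝ ℂ) (Complex.exp (θ * Complex.I)))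

section Norms

open scoped Matrix.Norms.L2Operator

/-- The `H_∞` norm: supremum over all frequencies of the largest singular value (the operator
norm for the Euclidean norms) of the frequency response. -/
noncomputable def hinfNorm {α β : Type} [Fintype α] [Fintype β] [DecidableEq β]
    (G : TransferMatrix α β) : ℝ≥0∞ :=
  ⨆ θ : ℝ, ENNReal.ofReal ‖freqResponse G θ‖

end Norms

/-- The `H_2` norm: `((1/2π) ∫_{-π}^{π} ‖G(e^{iθ})‖_F² dθ)^{1/2}`. -/
noncomputable def h2Norm {α β : Type} [Fintype α] [Fintype β]
    (G : TransferMatrix α β) : ℝ≥0∞ :=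
  (ENNReal.ofReal (1 / (2 * Real.pi)) *
    ∫⁻ θ in Set.Icc (-Real.pi) Real.pi,
      ENNReal.ofReal (∑ i, ∑ j, ‖freqResponse G θ i j‖ ^ 2)) ^ (1 / 2 : ℝ)

/-! ### Time domain: impulse responses, the feedback loop, the LQG cost -/

/-- The expansion of a proper rational function `g` in powers of `z⁻¹`: writing `x = z⁻¹` and
`N = deg (denom g)`, it is the power series of `(x^N num(1/x)) / (x^N denom(1/x))`. -/
noncomputable def expansionAtInfinity (g : RatFunc ℝ) : PowerSeries ℝ :=
  (Polynomial.reflect g.denom.natDegree g.num : PowerSeries ℝ) *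
    (Polynomial.reflect g.denom.natDegree g.denom : PowerSeries ℝ)⁻¹

/-- The spectral components `G_k` of a proper transfer matrix `G(z) = ∑_k G_k z^{-k}`. -/
noncomputable def spectralComponent {α β : Type} (G : TransferMatrix α β) (k : ℕ) :
    Matrix α β ℝ :=
  Matrix.of fun i j => PowerSeries.coeff k (expansionAtInfinity (G i j))

/-- The feedback equations `y = G u + v`, `u = K y + w`, in the time domain (zero initial
conditions), as equations between sequences. -/
def LoopEq {p m : ℕ} (G : TransferMatrix (Fin p) (Fin m)) (K : TransferMatrix (Fin m) (Fin p))
    (v : ℕ → Fin p → ℝ) (w : ℕ → Fin m → ℝ) (y : ℕ → Fin p → ℝ) (u : ℕ → Fin m → ℝ) : Prop :=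
  ∀ t, y t = (∑ k ∈ Finset.range (t + 1), (spectralComponent G k).mulVec (u (t - k))) + v t ∧
    u t = (∑ k ∈ Finset.range (t + 1), (spectralComponent K k).mulVec (y (t - k))) + w t

/-- The feedback loop is well posed: all exogenous sequences determine the signals uniquely. -/
def WellPosed {p m : ℕ} (G : TransferMatrix (Fin p) (Fin m))
    (K : TransferMatrix (Fin m) (Fin p)) : Prop :=
  ∀ (v : ℕ → Fin p → ℝ) (w : ℕ → Fin m → ℝ),
    ∃! yu : (ℕ → Fin p → ℝ) × (ℕ → Fin m → ℝ), LoopEq G K v w yu.1 yu.2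

/-- `v_t ∼ N(0, I_p)`, `w_t ∼ N(0, I_m)`, all independent: the scalar coordinates of all noise
vectors form an independent family of standard Gaussian variables. -/
structure IsWhiteNoise {p m : ℕ} {Ω : Type*} [MeasurableSpace Ω]
    (P : MeasureTheory.Measure Ω) (v : ℕ → Ω → Fin p → ℝ) (w : ℕ → Ω → Fin m → ℝ) : Prop where
  law_v : ∀ t i, ProbabilityTheory.HasLaw (fun ω => v t ω i)
    (ProbabilityTheory.gaussianReal 0 1) P
  law_w : ∀ t j, ProbabilityTheory.HasLaw (fun ω => w t ω j)
    (ProbabilityTheory.gaussianReal 0 1) P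
  indep : ProbabilityTheory.iIndepFun
    (fun (a : ℕ × (Fin p ⊕ Fin m)) ω => Sum.elim (v a.1 ω) (w a.1 ω) a.2) P

/-- `E[(1/T) ∑_{t=0}^{T} (y_tᵀ y_t + u_tᵀ u_t)]`. -/
noncomputable def avgCost {p m : ℕ} {Ω : Type*} [MeasurableSpace Ω]
    (P : MeasureTheory.Measure Ω) (y : ℕ → Ω → Fin p → ℝ) (u : ℕ → Ω → Fin m → ℝ) (T : ℕ) :
    ℝ≥0∞ :=
  ∫⁻ ω, ENNReal.ofReal ((1 / (T : ℝ)) * ∑ t ∈ Finset.range (T + 1),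
    (dotProduct (y t ω) (y t ω) + dotProduct (u t ω) (u t ω))) ∂P

open Classical in
/-- The infinite-horizon LQG cost, in `[0, ∞]`, of the plant `G` in feedback with the controller
`K`; it is `∞` if the loop is not well posed. -/
noncomputable def lqgCost {p m : ℕ} {Ω : Type*} [MeasurableSpace Ω]
    (P : MeasureTheory.Measure Ω) (v : ℕ → Ω → Fin p → ℝ) (w : ℕ → Ω → Fin m → ℝ)
    (G : TransferMatrix (Fin p) (Fin m)) (K : TransferMatrix (Fin m) (Fin p)) : ℝ≥0∞ :=
  if h : WellPosed G K then
    Filter.limsup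
      (avgCost P
        (fun t ω => (h (fun s => v s ω) (fun s => w s ω)).choose.1 t)
        (fun t ω => (h (fun s => v s ω) (fun s => w s ω)).choose.2 t))
      Filter.atTop
  else ⊤

/-! ### The robust LQG problem -/

/-- The uncertainty set `{Δ ∈ RH_∞ : ‖Δ‖_∞ < ε}`. -/
def uncertaintySet (p m : ℕ) (ε : ℝ) : Set (TransferMatrix (Fin p) (Fin m)) :=
  {Δ | IsRHinf Δ ∧ hinfNorm Δ < ENNReal.ofReal ε}

/-- The worst-case LQG cost of the controller `K` over all plants `Ghat + Δ`, `‖Δ‖_∞ < ε`. -/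
noncomputable def worstCaseCost {p m : ℕ} {Ω : Type*} [MeasurableSpace Ω]
    (P : MeasureTheory.Measure Ω) (v : ℕ → Ω → Fin p → ℝ) (w : ℕ → Ω → Fin m → ℝ)
    (Ghat : TransferMatrix (Fin p) (Fin m)) (ε : ℝ) (K : TransferMatrix (Fin m) (Fin p)) :
    ℝ≥0∞ :=
  ⨆ Δ ∈ uncertaintySet p m ε, lqgCost P v w (Ghat + Δ) K

/-! ### Closed-loop responses and the input-output parameterization -/

/-- A quadruple `(Y, W, U, Z)` of transfer matrices. -/
@[ext]
structure Responses (p m : ℕ) where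
  Y : TransferMatrix (Fin p) (Fin p)
  W : TransferMatrix (Fin p) (Fin m)
  U : TransferMatrix (Fin m) (Fin p)
  Z : TransferMatrix (Fin m) (Fin m)

/-- The block matrix `[Y W; U Z]`. -/
def Responses.block {p m : ℕ} (x : Responses p m) :
    TransferMatrix (Fin p ⊕ Fin m) (Fin p ⊕ Fin m) :=
  Matrix.fromBlocks x.Y x.W x.U x.Z

/-- The controller `K = U Y⁻¹`. -/
noncomputable def Responses.controller {p m : ℕ} (x : Responses p m) :
    TransferMatrix (Fin m) (Fin p) :=
  x.U * x.Y⁻¹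

/-- The closed-loop responses from `(v, w)` to `(y, u)` of plant `G` and controller `K`. -/
noncomputable def closedLoop {p m : ℕ} (G : TransferMatrix (Fin p) (Fin m))
    (K : TransferMatrix (Fin m) (Fin p)) : Responses p m where
  Y := (1 - G * K)⁻¹
  W := (1 - G * K)⁻¹ * G
  U := K * (1 - G * K)⁻¹
  Z := (1 - K * G)⁻¹

/-- Internal stability of the feedback loop: `I - G K` is invertible and all four closed-loop
responses are proper and stable. -/
def InternallyStabilizes {p m : ℕ} (G : TransferMatrix (Fin p) (Fin m))
    (K : TransferMatrix (Fin m) (Fin p)) : Prop :=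
  IsUnit (1 - G * K).det ∧ IsRHinf (closedLoop G K).block

/-- The constraints of the input-output formulation: the two affine achievability constraints,
stability, and `‖U‖_∞ ≤ 1/ε`. -/
structure IOPConstraints {p m : ℕ} (Ghat : TransferMatrix (Fin p) (Fin m)) (ε : ℝ)
    (x : Responses p m) : Prop where
  left_achievable : Matrix.fromCols 1 (-Ghat) * x.block = Matrix.fromCols 1 0
  right_achievable : x.block * Matrix.fromRows (-Ghat) 1 = Matrix.fromRows 0 1
  stable_Y : IsRHinf x.Y
  stable_W : IsRHinf x.W
  stable_U : IsRHinf x.U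
  stable_Z : IsRHinf x.Z
  norm_U : hinfNorm x.U ≤ ENNReal.ofReal (1 / ε)

/-- The feasible set of the input-output formulation. The last condition says that `Y⁻¹` exists
as a proper transfer matrix; it holds automatically if `Ghat` is strictly proper. -/
def iopFeasible {p m : ℕ} (Ghat : TransferMatrix (Fin p) (Fin m)) (ε : ℝ) :
    Set (Responses p m) :=
  {x | IOPConstraints Ghat ε x ∧ IsUnit x.Y.det ∧ IsProper x.Y⁻¹}

/-- The responses on the perturbed plant `Ghat + Δ`, expressed through the nominal ones. -/
noncomputable def perturbedResponses {p m : ℕ} (Ghat Δ : TransferMatrix (Fin p) (Fin m))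
    (x : Responses p m) : Responses p m where
  Y := x.Y * (1 - Δ * x.U)⁻¹
  W := x.Y * (1 - Δ * x.U)⁻¹ * (Ghat + Δ)
  U := x.U * (1 - Δ * x.U)⁻¹
  Z := (1 - x.U * Δ)⁻¹ * x.Z

/-- The inner maximum of the input-output formulation. -/
noncomputable def iopObjective {p m : ℕ} (Ghat : TransferMatrix (Fin p) (Fin m)) (ε : ℝ)
    (x : Responses p m) : ℝ≥0∞ :=
  ⨆ Δ ∈ uncertaintySet p m ε, h2Norm (perturbedResponses Ghat Δ x).block

end RobustLQG

open RobustLQG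

/-! Put `x = z⁻¹` and expand proper transfer functions in `ℝ⟦x⟧`. The loop equations become the
linear system `[I, -G; -K, I] (y, u) = (v, w)` over power series, so well-posedness means that the
closed-loop block matrix `H = [Y, W; U, Z]` exists and is proper (`wellPosed_iff`). The signals are
the noise convolved with the coefficients `H_k`. Whiteness gives `E(|y_t|² + |u_t|²) = ∑_{k ≤ t}
‖H_k‖_F²`, and averaging over time gives the cost `∑_k ‖H_k‖_F²` in `[0, ∞]` (`lqgCost_eq_tsum`).
For rational `H`, finiteness of this sum excludes poles in `|z| ≥ 1`
(`mem_stableSubring_of_summable_sq`), and Parseval then identifies it with the squared `H₂` norm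
(`h2Norm_sq_eq_tsum`). So finite cost is the same as internal stability.

Robustness rests on `I - (Ĝ + Δ)K = (I - ΔU)(I - ĜK)`, where `U` is the nominal response: the only
inverses in the perturbed responses are those of `I - ΔU` and `I - UΔ` (`closedLoop_perturbed`). If
`‖U‖_∞ ≤ 1/ε`, these inverses are stable, because the maximum principle carries `‖ΔU‖ < 1` from the
circle to the whole exterior of the disc (`small_gain`). If `‖U‖_∞ > 1/ε`, some admissible `Δ`
destabilizes the loop (`exists_destabilizing`). Since `Δ` must be real-rational, complex phases are
imitated by delays: `Δ` has rank one, with entries `r⁻¹ B_i A_j z^{-(n_i + l_j)}`. At an irrational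
frequency delays realize a dense set of phases, and one more common delay makes the total phase
vanish at a nearby frequency.

Hence feasible responses correspond to controllers of finite cost, the inverse map sending `K` to
its closed loop on `Ĝ`. Objectives match after squaring, an order isomorphism of `[0, ∞]`. All other
proper controllers have infinite worst-case cost, while `K = 0` has finite worst-case cost because
`Ĝ` is stable; so they affect neither the value nor the minimizers. -/

namespace RobustLQG

/-! ### Subrings of proper and of stable rational functions -/

/-- Properness of a rational function in terms of its degree. -/
theorem num_degree_le_iff_intDegree_nonpos (g : RatFunc ℝ) :
    g.num.degree ≤ g.denom.degree ↔ g.intDegree ≤ 0 := by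
  by_cases hg : g = 0
  · simp [hg]
  · rw [Polynomial.degree_eq_natDegree (RatFunc.num_ne_zero hg),
      Polynomial.degree_eq_natDegree g.denom_ne_zero, RatFunc.intDegree]
    simp

/-- The ring of proper rational functions. -/
def properSubring : Subring (RatFunc ℝ) where
  carrier := {g | g.num.degree ≤ g.denom.degree}
  mul_mem' := by
    intro a b ha hb
    simp only [Set.mem_ofPred_eq, num_degree_le_iff_intDegree_nonpos] at *
    by_cases h0 : a = 0
    · simp [h0]
    by_cases h1 : b = 0
    · simp [h1]
    rw [RatFunc.intDegree_mul h0 h1]; omega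
  one_mem' := by simp
  add_mem' := by
    intro a b ha hb
    simp only [Set.mem_ofPred_eq, num_degree_le_iff_intDegree_nonpos] at *
    by_cases h1 : b = 0
    · simpa [h1] using ha
    by_cases h0 : a + b = 0
    · simp [h0]
    exact (RatFunc.intDegree_add_le h1 h0).trans (max_le ha hb)
  zero_mem' := by simp
  neg_mem' := by
    intro a ha
    simp only [Set.mem_ofPred_eq, num_degree_le_iff_intDegree_nonpos] at *
    simpa using ha

theorem mem_properSubring {g : RatFunc ℝ} :
    g ∈ properSubring ↔ g.num.degree ≤ g.denom.degree := Iff.rfl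

/-- The ring of proper rational functions all of whose poles lie in the open unit disc. -/
def stableSubring : Subring (RatFunc ℝ) where
  carrier := {g | g ∈ properSubring ∧ ∀ z : ℂ, 1 ≤ ‖z‖ → Polynomial.aeval z g.denom ≠ 0}
  mul_mem' := by
    rintro a b ⟨ha, ha'⟩ ⟨hb, hb'⟩
    refine ⟨mul_mem ha hb, fun z hz h => ?_⟩
    have := Polynomial.aeval_eq_zero_of_dvd_aeval_eq_zero (RatFunc.denom_mul_dvd a b) h
    rw [map_mul, mul_eq_zero] at this
    exact this.elim (ha' z hz) (hb' z hz)
  one_mem' := ⟨one_mem _, by simp⟩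
  add_mem' := by
    rintro a b ⟨ha, ha'⟩ ⟨hb, hb'⟩
    refine ⟨add_mem ha hb, fun z hz h => ?_⟩
    have := Polynomial.aeval_eq_zero_of_dvd_aeval_eq_zero (RatFunc.denom_add_dvd a b) h
    rw [map_mul, mul_eq_zero] at this
    exact this.elim (ha' z hz) (hb' z hz)
  zero_mem' := ⟨zero_mem _, by simp⟩
  neg_mem' := by
    rintro a ⟨ha, ha'⟩
    refine ⟨neg_mem ha, fun z hz h => ?_⟩
    have hd : (-a).denom ∣ a.denom := by
      rw [RatFunc.denom_dvd a.denom_ne_zero]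
      exact ⟨-a.num, by rw [map_neg, neg_div, RatFunc.num_div_denom]⟩
    exact ha' z hz (Polynomial.aeval_eq_zero_of_dvd_aeval_eq_zero hd h)

theorem isRHinf_iff {α β : Type} {G : TransferMatrix α β} :
    IsRHinf G ↔ ∀ i j, G i j ∈ stableSubring :=
  ⟨fun h i j => ⟨h.1 i j, h.2 i j⟩, fun h => ⟨fun i j => (h i j).1, fun i j => (h i j).2⟩⟩

theorem div_mem_properSubring {P Q : Polynomial ℝ} (hQ : Q ≠ 0) (h : P.degree ≤ Q.degree) :
    algebraMap _ (RatFunc ℝ) P / algebraMap _ (RatFunc ℝ) Q ∈ properSubring := by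
  rw [mem_properSubring, num_degree_le_iff_intDegree_nonpos]
  by_cases hP : P = 0
  · simp [hP]
  rw [RatFunc.intDegree_div (by simpa using hP) (by simpa using hQ),
    RatFunc.intDegree_polynomial, RatFunc.intDegree_polynomial]
  have := Polynomial.natDegree_le_natDegree h
  omega

/-- The fraction need not be reduced: cancellation can only remove poles. -/
theorem div_mem_stableSubring {P Q : Polynomial ℝ} (h : P.degree ≤ Q.degree)
    (hQ : ∀ z : ℂ, 1 ≤ ‖z‖ → Polynomial.aeval z Q ≠ 0) :
    algebraMap _ (RatFunc ℝ) P / algebraMap _ (RatFunc ℝ) Q ∈ stableSubring := by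
  have hQ0 : Q ≠ 0 := by
    rintro rfl
    exact hQ 1 (by simp) (by simp)
  refine ⟨div_mem_properSubring hQ0 h, fun z hz h0 => hQ z hz ?_⟩
  exact Polynomial.aeval_eq_zero_of_dvd_aeval_eq_zero (RatFunc.denom_div_dvd P Q) h0

theorem C_mem_stableSubring (c : ℝ) : RatFunc.C c ∈ stableSubring :=
  ⟨by simp [mem_properSubring, Polynomial.degree_C_le], by simp⟩

theorem inv_X_mem_stableSubring : (RatFunc.X : RatFunc ℝ)⁻¹ ∈ stableSubring := by
  have := div_mem_stableSubring (P := 1) (Q := Polynomial.X) (by simp) (fun z hz => by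
    rw [Polynomial.aeval_X]; rintro rfl; simp at hz; linarith)
  simpa using this

/-! ### The expansion at infinity is a ring homomorphism -/

theorem constantCoeff_reflect_denom (g : RatFunc ℝ) :
    PowerSeries.constantCoeff
      ((Polynomial.reflect g.denom.natDegree g.denom : Polynomial ℝ) : PowerSeries ℝ) = 1 := by
  rw [← PowerSeries.coeff_zero_eq_constantCoeff_apply, Polynomial.coeff_coe,
    Polynomial.coeff_reflect, Polynomial.revAt_zero]
  exact g.monic_denom

theorem reflect_denom_mul_expansion (g : RatFunc ℝ) :
    ((Polynomial.reflect g.denom.natDegree g.denom : Polynomial ℝ) : PowerSeries ℝ) *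
      expansionAtInfinity g =
    ((Polynomial.reflect g.denom.natDegree g.num : Polynomial ℝ) : PowerSeries ℝ) := by
  rw [expansionAtInfinity, mul_comm, mul_assoc, PowerSeries.inv_mul_cancel, mul_one]
  rw [constantCoeff_reflect_denom]; exact one_ne_zero

theorem natDegree_num_le {g : RatFunc ℝ} (hg : g ∈ properSubring) :
    g.num.natDegree ≤ g.denom.natDegree := Polynomial.natDegree_le_natDegree hg

/-- Allows the expansion to be computed from any fraction `P / Q`, reduced or not, and any common
degree bound `N`. Sums and products need this, since their natural numerator and denominator may
share factors. Reflection turns the cross-multiplied identity into one in `x = z⁻¹`, and the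
reflected denominator cancels because it is a nonzero power series. -/
theorem reflect_mul_expansion_of_eq {g : RatFunc ℝ} (hg : g ∈ properSubring)
    {P Q : Polynomial ℝ} {N : ℕ} (hP : P.natDegree ≤ N) (hQ : Q.natDegree ≤ N)
    (h : g.num * Q = P * g.denom) :
    ((Polynomial.reflect N Q : Polynomial ℝ) : PowerSeries ℝ) * expansionAtInfinity g =
      ((Polynomial.reflect N P : Polynomial ℝ) : PowerSeries ℝ) := by
  set n := g.denom.natDegree with hn
  have h1 : Polynomial.reflect n g.num * Polynomial.reflect N Q =
      Polynomial.reflect N P * Polynomial.reflect n g.denom := by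
    rw [← Polynomial.reflect_mul _ _ (natDegree_num_le hg) hQ,
      ← Polynomial.reflect_mul _ _ hP le_rfl, h, add_comm]
  have h2 : ((Polynomial.reflect n g.num : Polynomial ℝ) : PowerSeries ℝ) *
      ((Polynomial.reflect N Q : Polynomial ℝ) : PowerSeries ℝ) =
      ((Polynomial.reflect N P : Polynomial ℝ) : PowerSeries ℝ) *
      ((Polynomial.reflect n g.denom : Polynomial ℝ) : PowerSeries ℝ) := by
    rw [← Polynomial.coe_mul, h1, Polynomial.coe_mul]
  have h0 : ((Polynomial.reflect n g.denom : Polynomial ℝ) : PowerSeries ℝ) ≠ 0 := by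
    intro h0
    have := constantCoeff_reflect_denom g
    rw [← hn, h0] at this
    simp at this
  apply mul_left_cancel₀ h0
  rw [mul_left_comm, reflect_denom_mul_expansion g, ← hn, mul_comm, h2, mul_comm]

theorem reflect_denom_ne_zero (g : RatFunc ℝ) :
    ((Polynomial.reflect g.denom.natDegree g.denom : Polynomial ℝ) : PowerSeries ℝ) ≠ 0 := by
  intro h
  have := constantCoeff_reflect_denom g
  rw [h] at this
  simp at this

theorem expansionAtInfinity_mul {a b : RatFunc ℝ} (ha : a ∈ properSubring)
    (hb : b ∈ properSubring) :
    expansionAtInfinity (a * b) = expansionAtInfinity a * expansionAtInfinity b := by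
  have hda := reflect_denom_ne_zero a
  have hdb := reflect_denom_ne_zero b
  have hna := natDegree_num_le ha
  have hnb := natDegree_num_le hb
  have := reflect_mul_expansion_of_eq (mul_mem ha hb) (P := a.num * b.num)
    (Q := a.denom * b.denom) (N := a.denom.natDegree + b.denom.natDegree)
    (Polynomial.natDegree_mul_le.trans (add_le_add hna hnb)) Polynomial.natDegree_mul_le
    (by rw [RatFunc.num_denom_mul])
  rw [Polynomial.reflect_mul _ _ le_rfl le_rfl, Polynomial.reflect_mul _ _ hna hnb,
    Polynomial.coe_mul, Polynomial.coe_mul, ← reflect_denom_mul_expansion a,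
    ← reflect_denom_mul_expansion b] at this
  refine mul_left_cancel₀ (mul_ne_zero hda hdb) (this.trans ?_)
  ring

theorem expansionAtInfinity_add {a b : RatFunc ℝ} (ha : a ∈ properSubring)
    (hb : b ∈ properSubring) :
    expansionAtInfinity (a + b) = expansionAtInfinity a + expansionAtInfinity b := by
  have hda := reflect_denom_ne_zero a
  have hdb := reflect_denom_ne_zero b
  have hna := natDegree_num_le ha
  have hnb := natDegree_num_le hb
  have h1 : (a.num * b.denom).natDegree ≤ a.denom.natDegree + b.denom.natDegree :=
    Polynomial.natDegree_mul_le.trans (add_le_add hna le_rfl)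
  have h2 : (a.denom * b.num).natDegree ≤ a.denom.natDegree + b.denom.natDegree :=
    Polynomial.natDegree_mul_le.trans (add_le_add le_rfl hnb)
  have := reflect_mul_expansion_of_eq (add_mem ha hb)
    (P := a.num * b.denom + a.denom * b.num)
    (Q := a.denom * b.denom) (N := a.denom.natDegree + b.denom.natDegree)
    ((Polynomial.natDegree_add_le _ _).trans (max_le h1 h2)) Polynomial.natDegree_mul_le
    (by rw [RatFunc.num_denom_add])
  rw [Polynomial.reflect_mul _ _ le_rfl le_rfl, Polynomial.reflect_add,
    Polynomial.reflect_mul _ _ hna le_rfl, Polynomial.reflect_mul _ _ le_rfl hnb,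
    Polynomial.coe_mul, Polynomial.coe_add, Polynomial.coe_mul, Polynomial.coe_mul,
    ← reflect_denom_mul_expansion a, ← reflect_denom_mul_expansion b] at this
  refine mul_left_cancel₀ (mul_ne_zero hda hdb) (this.trans ?_)
  ring

theorem expansionAtInfinity_zero : expansionAtInfinity 0 = 0 := by
  simp [expansionAtInfinity]

theorem expansionAtInfinity_one : expansionAtInfinity 1 = 1 := by
  simp [expansionAtInfinity]

/-- The expansion at infinity as a ring homomorphism. -/
noncomputable def expandHom : properSubring →+* PowerSeries ℝ where
  toFun g := expansionAtInfinity g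
  map_one' := expansionAtInfinity_one
  map_mul' a b := expansionAtInfinity_mul a.2 b.2
  map_zero' := expansionAtInfinity_zero
  map_add' a b := expansionAtInfinity_add a.2 b.2

theorem expandHom_apply (g : properSubring) : expandHom g = expansionAtInfinity g := rfl

theorem constantCoeff_expansionAtInfinity (g : RatFunc ℝ) :
    PowerSeries.constantCoeff (expansionAtInfinity g) = g.num.coeff g.denom.natDegree := by
  have := congrArg PowerSeries.constantCoeff (reflect_denom_mul_expansion g)
  rw [map_mul, constantCoeff_reflect_denom, one_mul] at this
  rw [this, ← PowerSeries.coeff_zero_eq_constantCoeff_apply, Polynomial.coeff_coe,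
    Polynomial.coeff_reflect, Polynomial.revAt_zero]

/-- A nonzero constant coefficient forces the degree of the numerator to be at least that of the
denominator. -/
theorem inv_mem_properSubring {g : RatFunc ℝ}
    (h : PowerSeries.constantCoeff (expansionAtInfinity g) ≠ 0) : g⁻¹ ∈ properSubring := by
  rw [constantCoeff_expansionAtInfinity] at h
  have h1 := Polynomial.le_natDegree_of_ne_zero h
  rw [mem_properSubring, num_degree_le_iff_intDegree_nonpos, RatFunc.intDegree_inv,
    RatFunc.intDegree]
  omega

theorem constantCoeff_eq_zero_of_strictlyProper {g : RatFunc ℝ}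
    (h : g.num.degree < g.denom.degree) :
    PowerSeries.constantCoeff (expansionAtInfinity g) = 0 := by
  rw [constantCoeff_expansionAtInfinity]
  exact Polynomial.coeff_eq_zero_of_degree_lt (by
    rwa [← Polynomial.degree_eq_natDegree g.denom_ne_zero])

/-! ### Power series with absolutely summable coefficients -/

section Wiener

variable {𝕜 : Type*} [NormedField 𝕜]

/-- A power series whose coefficients are absolutely summable. -/
def AbsSummable (φ : PowerSeries 𝕜) : Prop := Summable fun k => ‖PowerSeries.coeff k φ‖

theorem AbsSummable.mul {φ ψ : PowerSeries 𝕜} (hφ : AbsSummable φ) (hψ : AbsSummable ψ) :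
    AbsSummable (φ * ψ) := by
  have := summable_norm_sum_mul_antidiagonal_of_summable_norm hφ hψ
  simpa only [AbsSummable, PowerSeries.coeff_mul] using this

theorem absSummable_coe (P : Polynomial 𝕜) : AbsSummable (P : PowerSeries 𝕜) := by
  refine summable_of_ne_finset_zero (s := P.support) fun k hk => ?_
  rw [Polynomial.coeff_coe, Polynomial.notMem_support_iff.mp hk, norm_zero]

/-- The reversed product is `∏ (1 - a X)`. Each factor is inverted by a geometric series with ratio
of modulus less than one, and absolute summability survives Cauchy products. -/
theorem exists_absSummable_inverse (s : Multiset 𝕜) (hs : ∀ a ∈ s, ‖a‖ < 1) :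
    ∃ ψ : PowerSeries 𝕜, AbsSummable ψ ∧
      (((s.map fun a => Polynomial.X - Polynomial.C a).prod.reverse : Polynomial 𝕜) :
        PowerSeries 𝕜) * ψ = 1 := by
  induction s using Multiset.induction with
  | empty => exact ⟨1, by simpa using absSummable_coe (1 : Polynomial 𝕜), by
    rw [Multiset.map_zero, Multiset.prod_zero, mul_one, ← Polynomial.C_1, Polynomial.reverse_C,
      Polynomial.coe_C, map_one]⟩
  | cons a s ih =>
    obtain ⟨ψ, hψ, h⟩ := ih fun b hb => hs b (Multiset.mem_cons_of_mem hb)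
    have ha := hs a (Multiset.mem_cons_self a s)
    have hr : (Polynomial.X - Polynomial.C a).reverse = 1 - Polynomial.C a * Polynomial.X := by
      have h1 : (Polynomial.X - Polynomial.C a : Polynomial 𝕜) =
          Polynomial.X * 1 + Polynomial.C (-a) := by simp [sub_eq_add_neg]
      rw [h1, Polynomial.reverse, Polynomial.reflect_add, mul_one, Polynomial.natDegree_X_add_C,
        Polynomial.reflect_one_X, Polynomial.reflect_C]
      simp [sub_eq_add_neg]
    refine ⟨ψ * PowerSeries.mk fun k => a ^ k, hψ.mul ?_, ?_⟩
    · simpa [AbsSummable] using summable_geometric_of_lt_one (norm_nonneg a) ha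
    · rw [Multiset.map_cons, Multiset.prod_cons, Polynomial.reverse_mul_of_domain, hr,
        Polynomial.coe_mul]
      have h2 : ((1 - Polynomial.C a * Polynomial.X : Polynomial 𝕜) : PowerSeries 𝕜) *
          PowerSeries.mk (fun k => a ^ k) = 1 := by
        ext n
        rw [Polynomial.coe_sub, Polynomial.coe_mul, Polynomial.coe_one, Polynomial.coe_C,
          Polynomial.coe_X, sub_mul, one_mul, map_sub, mul_assoc, PowerSeries.coeff_C_mul]
        cases n with
        | zero => simp
        | succ n =>
          rw [PowerSeries.coeff_succ_X_mul, PowerSeries.coeff_mk, PowerSeries.coeff_mk,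
            PowerSeries.coeff_one]
          simp [pow_succ']
      calc _ = (((1 - Polynomial.C a * Polynomial.X : Polynomial 𝕜) : PowerSeries 𝕜) *
          PowerSeries.mk (fun k => a ^ k)) * ((((s.map fun a => Polynomial.X -
            Polynomial.C a).prod.reverse : Polynomial 𝕜) : PowerSeries 𝕜) * ψ) := by ring
        _ = 1 := by rw [h, h2, one_mul]

end Wiener

/-- Over `ℂ` the denominator splits with all roots in the open disc, so its reflection has an
absolutely summable inverse. The passage to complex coefficients does not change norms. -/
theorem absSummable_expansionAtInfinity {g : RatFunc ℝ} (hg : g ∈ stableSubring) :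
    AbsSummable (expansionAtInfinity g) := by
  set Q := g.denom.map (algebraMap ℝ ℂ) with hQ
  have hQm : Q.Monic := g.monic_denom.map _
  have hprod := (IsAlgClosed.splits Q).eq_prod_roots_of_monic hQm
  obtain ⟨ψ, hψ, h⟩ := exists_absSummable_inverse Q.roots (fun a ha => by
    by_contra! hlt
    refine hg.2 a hlt ?_
    have := Polynomial.isRoot_of_mem_roots ha
    rwa [Polynomial.IsRoot, hQ, Polynomial.eval_map_algebraMap] at this)
  rw [← hprod] at h
  have key := congrArg (PowerSeries.map (algebraMap ℝ ℂ)) (reflect_denom_mul_expansion g)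
  rw [map_mul, ← Polynomial.polynomial_map_coe, ← Polynomial.polynomial_map_coe,
    ← Polynomial.reflect_map, ← hQ] at key
  have hdeg : Q.natDegree = g.denom.natDegree := Polynomial.natDegree_map _
  rw [Polynomial.reverse, hdeg] at h
  have h3 : PowerSeries.map (algebraMap ℝ ℂ) (expansionAtInfinity g) =
      ψ * ((Polynomial.map (algebraMap ℝ ℂ) (Polynomial.reflect g.denom.natDegree g.num) :
        Polynomial ℂ) : PowerSeries ℂ) := by
    rw [← key, ← mul_assoc, mul_comm ψ, h, one_mul]
  have h4 := hψ.mul (absSummable_coe (Polynomial.map (algebraMap ℝ ℂ)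
    (Polynomial.reflect g.denom.natDegree g.num)))
  rw [← h3] at h4
  simpa [AbsSummable] using h4

/-- The sum of a real power series at a complex point. -/
noncomputable def psEval (φ : PowerSeries ℝ) (x : ℂ) : ℂ :=
  ∑' k, ((PowerSeries.coeff k φ : ℝ) : ℂ) * x ^ k

/-- Absolute convergence of a real power series at a complex point. -/
def PsSummable (φ : PowerSeries ℝ) (x : ℂ) : Prop :=
  Summable fun k => ‖((PowerSeries.coeff k φ : ℝ) : ℂ) * x ^ k‖

theorem AbsSummable.psSummable {φ : PowerSeries ℝ} (h : AbsSummable φ) {x : ℂ} (hx : ‖x‖ ≤ 1) :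
    PsSummable φ x := by
  refine Summable.of_nonneg_of_le (fun _ => norm_nonneg _) (fun k => ?_) h
  rw [norm_mul, norm_pow, Complex.norm_real]
  exact mul_le_of_le_one_right (norm_nonneg _) (pow_le_one₀ (norm_nonneg _) hx)

theorem psEval_mul {φ ψ : PowerSeries ℝ} {x : ℂ} (hφ : PsSummable φ x) (hψ : PsSummable ψ x) :
    psEval (φ * ψ) x = psEval φ x * psEval ψ x := by
  rw [psEval, psEval, psEval, tsum_mul_tsum_eq_tsum_sum_antidiagonal_of_summable_norm hφ hψ]
  congr 1 with n
  rw [PowerSeries.coeff_mul]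
  push_cast
  rw [Finset.sum_mul]
  refine Finset.sum_congr rfl fun kl hkl => ?_
  rw [← Finset.HasAntidiagonal.mem_antidiagonal.mp hkl, pow_add]
  ring

theorem psEval_add {φ ψ : PowerSeries ℝ} {x : ℂ} (hφ : PsSummable φ x) (hψ : PsSummable ψ x) :
    psEval (φ + ψ) x = psEval φ x + psEval ψ x := by
  rw [psEval, psEval, psEval, ← Summable.tsum_add hφ.of_norm hψ.of_norm]
  congr 1 with n
  rw [map_add]; push_cast; ring

theorem psEval_coe (P : Polynomial ℝ) (x : ℂ) :
    psEval (P : PowerSeries ℝ) x = Polynomial.aeval x P := by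
  rw [psEval, tsum_eq_sum (s := Finset.range (P.natDegree + 1)), Polynomial.aeval_eq_sum_range]
  · refine Finset.sum_congr rfl fun k _ => ?_
    rw [Polynomial.coeff_coe, Algebra.smul_def]; rfl
  · intro k hk
    rw [Polynomial.coeff_coe, Polynomial.coeff_eq_zero_of_natDegree_lt]
    · simp
    · simpa using hk

theorem psSummable_coe (P : Polynomial ℝ) (x : ℂ) : PsSummable (P : PowerSeries ℝ) x := by
  refine summable_of_ne_finset_zero (s := P.support) fun k hk => ?_
  rw [Polynomial.coeff_coe, Polynomial.notMem_support_iff.mp hk]; simp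

theorem psEval_one (x : ℂ) : psEval 1 x = 1 := by
  simpa using psEval_coe (1 : Polynomial ℝ) x

theorem psEval_zero (x : ℂ) : psEval 0 x = 0 := by simp [psEval]

theorem aeval_reflect (P : Polynomial ℝ) {N : ℕ} (hN : P.natDegree ≤ N) {z : ℂ} (hz : z ≠ 0) :
    Polynomial.aeval z⁻¹ (Polynomial.reflect N P) * z ^ N = Polynomial.aeval z P := by
  let _ := invertibleOfNonzero hz
  have := Polynomial.eval₂_reflect_mul_pow (algebraMap ℝ ℂ) z N P hN
  rwa [invOf_eq_inv] at this

/-- The evaluation homomorphism of stable transfer functions at a point `x = z⁻¹` of the closed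
unit disc. -/
noncomputable def discEval (x : ℂ) (hx : ‖x‖ ≤ 1) : stableSubring →+* ℂ where
  toFun g := psEval (expansionAtInfinity g) x
  map_one' := by simp [expansionAtInfinity_one, psEval_one]
  map_mul' a b := by
    simp only [Subring.coe_mul]
    rw [expansionAtInfinity_mul a.2.1 b.2.1]
    exact psEval_mul ((absSummable_expansionAtInfinity a.2).psSummable hx)
      ((absSummable_expansionAtInfinity b.2).psSummable hx)
  map_zero' := by simp [expansionAtInfinity_zero, psEval_zero]
  map_add' a b := by
    simp only [Subring.coe_add]
    rw [expansionAtInfinity_add a.2.1 b.2.1]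
    exact psEval_add ((absSummable_expansionAtInfinity a.2).psSummable hx)
      ((absSummable_expansionAtInfinity b.2).psSummable hx)

theorem discEval_apply (x : ℂ) (hx : ‖x‖ ≤ 1) (g : stableSubring) :
    discEval x hx g = psEval (expansionAtInfinity g) x := rfl

/-- Bridge between the time domain and the frequency domain: multiplied by the denominator, which
does not vanish at `z`, both sides give the numerator. -/
theorem psEval_expansion_eq_eval {g : RatFunc ℝ} (hg : g ∈ stableSubring) {z : ℂ}
    (hz : 1 ≤ ‖z‖) :
    psEval (expansionAtInfinity g) z⁻¹ = RatFunc.eval (algebraMap ℝ ℂ) z g := by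
  have hz0 : z ≠ 0 := by rintro rfl; simp at hz; linarith
  have hx : ‖z⁻¹‖ ≤ 1 := by rw [norm_inv]; exact inv_le_one_of_one_le₀ hz
  have h := congrArg (psEval · z⁻¹) (reflect_denom_mul_expansion g)
  rw [psEval_mul (psSummable_coe _ _) ((absSummable_expansionAtInfinity hg).psSummable hx),
    psEval_coe, psEval_coe] at h
  have h1 := aeval_reflect g.denom le_rfl hz0
  have h2 := aeval_reflect g.num (natDegree_num_le hg.1) hz0
  rw [← h, mul_right_comm, h1] at h2
  rw [RatFunc.eval, ← Polynomial.aeval_def, ← Polynomial.aeval_def, eq_div_iff (hg.2 z hz), mul_comm]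
  exact h2

/-- The closed disc in `x = z⁻¹` includes the point at infinity: nonvanishing at `x = 0` makes the
inverse proper, and nonvanishing elsewhere excludes its poles with `|z| ≥ 1`, which would be zeros
of the numerator of `g`. -/
theorem inv_mem_stableSubring {g : RatFunc ℝ} (hg : g ∈ stableSubring)
    (h : ∀ x : ℂ, ‖x‖ ≤ 1 → psEval (expansionAtInfinity g) x ≠ 0) : g⁻¹ ∈ stableSubring := by
  have h0 : psEval (expansionAtInfinity g) 0 =
      (PowerSeries.constantCoeff (expansionAtInfinity g) : ℝ) := by
    rw [psEval, tsum_eq_single 0]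
    · simp
    · intro k hk; simp [hk]
  have hc : PowerSeries.constantCoeff (expansionAtInfinity g) ≠ 0 := by
    intro hc
    refine h 0 (by simp) ?_
    rw [h0, hc]; simp
  have hg0 : g ≠ 0 := by
    rintro rfl
    simp [expansionAtInfinity_zero] at hc
  refine ⟨inv_mem_properSubring hc, fun z hz hd => ?_⟩
  have hn : Polynomial.aeval z g.num = 0 :=
    Polynomial.aeval_eq_zero_of_dvd_aeval_eq_zero (RatFunc.denom_inv_dvd hg0) hd
  refine h z⁻¹ (by rw [norm_inv]; exact inv_le_one_of_one_le₀ hz) ?_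
  rw [psEval_expansion_eq_eval hg hz, RatFunc.eval]
  rw [Polynomial.aeval_def] at hn
  rw [hn, zero_div]

/-! ### Square summable expansions have no poles outside the open disc -/

theorem psSummable_of_summable_sq {φ : PowerSeries ℝ}
    (h : Summable fun k => (PowerSeries.coeff k φ) ^ 2) {x : ℂ} (hx : ‖x‖ < 1) :
    PsSummable φ x := by
  have h2 : Summable fun k : ℕ => (‖x‖ ^ 2) ^ k :=
    summable_geometric_of_lt_one (by positivity) (by nlinarith [norm_nonneg x])
  refine Summable.of_nonneg_of_le (fun _ => norm_nonneg _) (fun k => ?_) (h.add h2)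
  rw [norm_mul, norm_pow, Complex.norm_real, ← pow_mul, mul_comm 2 k, pow_mul, Real.norm_eq_abs,
    ← sq_abs]
  nlinarith [sq_nonneg (|PowerSeries.coeff k φ| - ‖x‖ ^ k), sq_nonneg (|PowerSeries.coeff k φ|),
    sq_nonneg (‖x‖ ^ k)]

/-- Termwise weighted AM-GM in place of Cauchy–Schwarz. The free parameter `δ` is the point: it
makes the coefficient of `(1 - ‖x‖)⁻¹`, the growth rate of a simple pole, arbitrarily small. -/
theorem norm_psEval_le_of_summable_sq {φ : PowerSeries ℝ}
    (h : Summable fun k => (PowerSeries.coeff k φ) ^ 2) {x : ℂ} (hx : ‖x‖ < 1) {δ : ℝ}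
    (hδ : 0 < δ) :
    ‖psEval φ x‖ ≤ δ * (∑' k, (PowerSeries.coeff k φ) ^ 2) + δ⁻¹ * (1 - ‖x‖)⁻¹ := by
  have hx0 := norm_nonneg x
  have h2 : Summable fun k : ℕ => ‖x‖ ^ k := summable_geometric_of_lt_one hx0 hx
  have hs := psSummable_of_summable_sq h hx
  refine (norm_tsum_le_tsum_norm hs).trans ?_
  rw [← tsum_geometric_of_lt_one hx0 hx, ← tsum_mul_left, ← tsum_mul_left,
    ← (h.mul_left δ).tsum_add (h2.mul_left δ⁻¹)]
  refine hs.tsum_le_tsum (fun k => ?_) ((h.mul_left δ).add (h2.mul_left δ⁻¹))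
  rw [norm_mul, norm_pow, Complex.norm_real, Real.norm_eq_abs, ← sq_abs]
  set a := |PowerSeries.coeff k φ| with ha
  have ha0 : 0 ≤ a := abs_nonneg _
  set r := ‖x‖ ^ k with hr
  have hr0 : 0 ≤ r := by positivity
  have hr1 : r ≤ 1 := pow_le_one₀ hx0 hx.le
  have h3 : δ * δ⁻¹ = 1 := mul_inv_cancel₀ hδ.ne'
  have h4 : 0 ≤ δ⁻¹ := by positivity
  have h5 : 0 ≤ δ⁻¹ * (δ * a - r) ^ 2 := by positivity
  have h6 : δ⁻¹ * (δ * a - r) ^ 2 = δ * a ^ 2 - 2 * (a * r) + δ⁻¹ * r ^ 2 := by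
    field_simp; ring
  have h7 : δ⁻¹ * r ^ 2 ≤ δ⁻¹ * r := mul_le_mul_of_nonneg_left (by nlinarith) h4
  nlinarith [mul_nonneg ha0 hr0]

/-- A square summable series grows too slowly towards the unit circle to have a pole in the closed
disc. If `x = z⁻¹` is a root of the reflected denominator, the radial bounds show that it is also a
root of the reflected numerator, contradicting coprimality. -/
theorem mem_stableSubring_of_summable_sq {g : RatFunc ℝ} (hg : g ∈ properSubring)
    (h : Summable fun k => (PowerSeries.coeff k (expansionAtInfinity g)) ^ 2) :
    g ∈ stableSubring := by
  refine ⟨hg, fun z hz hd => ?_⟩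
  have hz0 : z ≠ 0 := by rintro rfl; simp at hz; linarith
  set x := z⁻¹ with hxdef
  have hx : ‖x‖ ≤ 1 := by rw [hxdef, norm_inv]; exact inv_le_one_of_one_le₀ hz
  set D := (Polynomial.reflect g.denom.natDegree g.denom).map (algebraMap ℝ ℂ) with hD
  set N := (Polynomial.reflect g.denom.natDegree g.num).map (algebraMap ℝ ℂ) with hN
  have hDx : D.IsRoot x := by
    have := aeval_reflect g.denom le_rfl hz0
    rw [hd, mul_eq_zero] at this
    rw [Polynomial.IsRoot, hD, Polynomial.eval_map_algebraMap]
    exact this.resolve_right (pow_ne_zero _ hz0)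
  obtain ⟨R, hR⟩ := Polynomial.dvd_iff_isRoot.mpr hDx
  set A := ∑' k, (PowerSeries.coeff k (expansionAtInfinity g)) ^ 2 with hA
  -- The factor `X - x` of `D` has size at most `1 - r` at the point `r x`, which cancels the growth
  -- `(1 - r)⁻¹` of the series.
  have key : ∀ δ : ℝ, 0 < δ → ∀ r : ℝ, 0 ≤ r → r < 1 →
      ‖N.eval (r * x)‖ ≤ ‖R.eval (r * x)‖ * ((1 - r) * (δ * A) + δ⁻¹) := by
    intro δ hδ r hr0 hr1
    have hrx : ‖(r * x : ℂ)‖ ≤ r := by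
      rw [norm_mul, Complex.norm_real, Real.norm_of_nonneg hr0]
      exact mul_le_of_le_one_right hr0 hx
    have hrx1 := hrx.trans_lt hr1
    have h1 := congrArg (psEval · (r * x)) (reflect_denom_mul_expansion g)
    rw [psEval_mul (psSummable_coe _ _) (psSummable_of_summable_sq h hrx1), psEval_coe,
      psEval_coe, ← Polynomial.eval_map_algebraMap, ← Polynomial.eval_map_algebraMap, ← hD, ← hN,
      hR] at h1
    rw [← h1, Polynomial.eval_mul, norm_mul, norm_mul, mul_comm ‖_‖ ‖R.eval _‖, mul_assoc]
    refine mul_le_mul_of_nonneg_left ?_ (norm_nonneg _)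
    have h2 := norm_psEval_le_of_summable_sq h hrx1 hδ
    have h3 : ‖Polynomial.eval (r * x : ℂ) (Polynomial.X - Polynomial.C x)‖ ≤ 1 - r := by
      have : Polynomial.eval (r * x : ℂ) (Polynomial.X - Polynomial.C x) =
          -((1 - r : ℝ) : ℂ) * x := by simp; ring
      rw [this, norm_mul, norm_neg, Complex.norm_real, Real.norm_of_nonneg (by linarith)]
      exact mul_le_of_le_one_right (by linarith) hx
    have h4 : (1 - ‖(r * x : ℂ)‖)⁻¹ ≤ (1 - r)⁻¹ := inv_anti₀ (by linarith) (by linarith)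
    have hA0 : 0 ≤ A := tsum_nonneg fun _ => sq_nonneg _
    calc _ ≤ (1 - r) * (δ * A + δ⁻¹ * (1 - r)⁻¹) := by
          refine mul_le_mul h3 (h2.trans ?_) (norm_nonneg _) (by linarith)
          have := mul_le_mul_of_nonneg_left h4 (inv_nonneg.mpr hδ.le)
          linarith
      _ = _ := by
          have : 1 - r ≠ 0 := by linarith
          field_simp
  -- First `r → 1` at fixed `δ`, afterwards `δ → ∞`.
  have lim : ∀ δ : ℝ, 0 < δ → ‖N.eval x‖ ≤ ‖R.eval x‖ * δ⁻¹ := by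
    intro δ hδ
    have hl : Filter.Tendsto (fun r : ℝ => ‖N.eval (r * x)‖) (nhdsWithin 1 (Set.Iio 1))
        (nhds ‖N.eval x‖) := by
      have : Continuous fun r : ℝ => ‖N.eval (r * x)‖ := by fun_prop
      simpa using (this.tendsto 1).mono_left nhdsWithin_le_nhds
    have hr : Filter.Tendsto
        (fun r : ℝ => ‖R.eval (r * x)‖ * ((1 - r) * (δ * A) + δ⁻¹)) (nhdsWithin 1 (Set.Iio 1))
        (nhds (‖R.eval x‖ * δ⁻¹)) := by
      have : Continuous fun r : ℝ => ‖R.eval (r * x)‖ * ((1 - r) * (δ * A) + δ⁻¹) := by fun_prop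
      simpa using (this.tendsto 1).mono_left nhdsWithin_le_nhds
    refine le_of_tendsto_of_tendsto hl hr ?_
    filter_upwards [Ioo_mem_nhdsLT (show (0 : ℝ) < 1 by norm_num)] with r hr
    exact key δ hδ r hr.1.le hr.2
  have hN0 : N.eval x = 0 := by
    have hl : Filter.Tendsto (fun δ : ℝ => ‖R.eval x‖ * δ⁻¹) Filter.atTop
        (nhds (‖R.eval x‖ * 0)) := tendsto_inv_atTop_zero.const_mul _
    have := ge_of_tendsto hl (by
      filter_upwards [Filter.eventually_gt_atTop 0] with δ hδ using lim δ hδ)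
    rw [mul_zero] at this
    exact norm_le_zero_iff.mp this
  have hn : Polynomial.aeval z g.num = 0 := by
    rw [← aeval_reflect g.num (natDegree_num_le hg) hz0, ← Polynomial.eval_map_algebraMap]
    rw [← hxdef, ← hN, hN0, zero_mul]
  obtain ⟨a, b, hab⟩ := g.isCoprime_num_denom
  have := congrArg (Polynomial.aeval z) hab
  simp [hn, hd] at this

/-! ### Parseval's identity and the `H_2` norm -/

theorem AbsSummable.continuous_psEval {φ : PowerSeries ℝ} (h : AbsSummable φ) :
    ContinuousOn (psEval φ) (Metric.closedBall 0 1) := by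
  refine continuousOn_tsum (u := fun k => ‖PowerSeries.coeff k φ‖) (fun k => by fun_prop) h
    fun k x hx => ?_
  rw [norm_mul, norm_pow, Complex.norm_real]
  exact mul_le_of_le_one_right (norm_nonneg _) (pow_le_one₀ (norm_nonneg _) (by simpa using hx))

theorem AbsSummable.differentiableOn_psEval {φ : PowerSeries ℝ} (h : AbsSummable φ) :
    DifferentiableOn ℂ (psEval φ) (Metric.ball 0 1) := by
  refine Complex.differentiableOn_tsum_of_summable_norm
    (u := fun k => ‖PowerSeries.coeff k φ‖) h (fun k => by fun_prop) Metric.isOpen_ball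
    fun k x hx => ?_
  rw [norm_mul, norm_pow, Complex.norm_real]
  exact mul_le_of_le_one_right (norm_nonneg _)
    (pow_le_one₀ (norm_nonneg _) (by simpa using (Metric.mem_ball.mp hx).le))

theorem norm_inv_exp_mul_I (θ : ℝ) : ‖(Complex.exp (θ * Complex.I))⁻¹‖ = 1 := by
  rw [norm_inv, Complex.norm_exp_ofReal_mul_I, inv_one]

theorem AbsSummable.continuous_psEval_circle {φ : PowerSeries ℝ} (h : AbsSummable φ) :
    Continuous fun θ : ℝ => psEval φ (Complex.exp (θ * Complex.I))⁻¹ := by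
  refine h.continuous_psEval.comp_continuous ?_ fun θ => ?_
  · exact Continuous.inv₀ (by fun_prop) fun θ => Complex.exp_ne_zero _
  · simp

theorem integral_exp_int_mul_I (n : ℤ) :
    ∫ θ in (-Real.pi)..Real.pi, Complex.exp (n * Complex.I * θ) =
      if n = 0 then ((2 * Real.pi : ℝ) : ℂ) else 0 := by
  split_ifs with h
  · subst h
    simp
    ring
  · have hc : (n * Complex.I : ℂ) ≠ 0 := mul_ne_zero (by exact_mod_cast h) Complex.I_ne_zero
    rw [integral_exp_mul_complex hc, div_eq_zero_iff]
    left
    rw [sub_eq_zero, Complex.exp_eq_exp_iff_exists_int]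
    refine ⟨n, ?_⟩
    push_cast
    ring

theorem AbsSummable.summable_sq {φ : PowerSeries ℝ} (h : AbsSummable φ) :
    Summable fun k => (PowerSeries.coeff k φ) ^ 2 := by
  have h1 := (summable_mul_of_summable_norm h h).comp_injective
    (i := fun k : ℕ => (k, k)) (fun a b hab => (Prod.mk.inj hab).1)
  simpa [Function.comp_def, sq] using h1

/-- Parseval: the squared modulus is an absolutely convergent double series, integration is
termwise, and orthogonality of the exponentials leaves the diagonal. -/
theorem AbsSummable.integral_norm_sq {φ : PowerSeries ℝ} (h : AbsSummable φ) :
    ∫ θ in (-Real.pi)..Real.pi, ‖psEval φ (Complex.exp (θ * Complex.I))⁻¹‖ ^ 2 =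
      2 * Real.pi * ∑' k, (PowerSeries.coeff k φ) ^ 2 := by
  set c : ℕ → ℝ := fun k => PowerSeries.coeff k φ with hc
  -- With `x = e^{-iθ}`, this is the term `c_j x^j` times the conjugate of `c_k x^k`.
  let F : ℕ × ℕ → ℝ → ℂ := fun jk θ =>
    ((c jk.1 * c jk.2 : ℝ) : ℂ) * Complex.exp (((jk.2 : ℤ) - (jk.1 : ℤ) : ℤ) * Complex.I * θ)
  have hpt : ∀ θ : ℝ, ((‖psEval φ (Complex.exp (θ * Complex.I))⁻¹‖ ^ 2 : ℝ) : ℂ) =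
      ∑' jk, F jk θ := by
    intro θ
    have hx := (norm_inv_exp_mul_I θ).le
    have hs := h.psSummable hx
    set x := (Complex.exp (θ * Complex.I))⁻¹ with hxd
    have hs' : Summable fun k => ‖starRingEnd ℂ ((c k : ℂ) * x ^ k)‖ := by
      simp only [RCLike.norm_conj]; exact hs
    push_cast
    rw [← Complex.mul_conj', psEval, Complex.conj_tsum, tsum_mul_tsum_of_summable_norm hs hs']
    congr 1 with jk
    have hconj : starRingEnd ℂ x = Complex.exp (θ * Complex.I) := by
      rw [hxd, map_inv₀, ← Complex.exp_conj, map_mul, Complex.conj_I, Complex.conj_ofReal,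
        mul_neg, Complex.exp_neg, inv_inv]
    rw [map_mul, map_pow, hconj, Complex.conj_ofReal, hxd, ← Complex.exp_neg, ← Complex.exp_nat_mul,
      ← Complex.exp_nat_mul]
    simp only [F]
    have : Complex.exp ((((jk.2 : ℤ) - (jk.1 : ℤ) : ℤ) : ℂ) * Complex.I * θ) =
        Complex.exp (jk.1 * (-(θ * Complex.I))) * Complex.exp (jk.2 * (θ * Complex.I)) := by
      rw [← Complex.exp_add]; congr 1; push_cast; ring
    rw [this]
    push_cast
    ring
  have hnorm : ∀ jk θ, ‖F jk θ‖ = ‖c jk.1‖ * ‖c jk.2‖ := by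
    intro jk θ
    have : (((jk.2 : ℤ) - (jk.1 : ℤ) : ℤ) : ℂ) * Complex.I * θ =
        ((((jk.2 : ℤ) - (jk.1 : ℤ) : ℤ) * θ : ℝ) : ℂ) * Complex.I := by push_cast; ring
    simp only [F]
    rw [norm_mul, this, Complex.norm_exp_ofReal_mul_I, mul_one, Complex.norm_real, norm_mul]
  have hcs : Summable fun jk : ℕ × ℕ => ‖c jk.1‖ * ‖c jk.2‖ := by
    have := summable_mul_of_summable_norm h.norm h.norm
    simpa [hc] using this
  have hint : ∀ jk, ∫ θ in (-Real.pi)..Real.pi, F jk θ =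
      if jk.1 = jk.2 then ((c jk.1 * c jk.2 * (2 * Real.pi) : ℝ) : ℂ) else 0 := by
    intro jk
    simp only [F]
    rw [intervalIntegral.integral_const_mul, integral_exp_int_mul_I]
    by_cases hjk : jk.1 = jk.2
    · simp [hjk]
    · rw [if_neg hjk, if_neg (by omega), mul_zero]
  have hle : -Real.pi ≤ Real.pi := by linarith [Real.pi_pos]
  have key : ∑' jk, ∫ θ in (-Real.pi)..Real.pi, F jk θ =
      ∫ θ in (-Real.pi)..Real.pi, ∑' jk, F jk θ := by
    simp only [intervalIntegral.integral_of_le hle]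
    refine MeasureTheory.integral_tsum_of_summable_integral_norm (fun jk => ?_) ?_
    · exact (intervalIntegrable_iff_integrableOn_Ioc_of_le hle).mp
        (Continuous.intervalIntegrable (by fun_prop) _ _)
    · simp only [hnorm, MeasureTheory.integral_const]
      exact hcs.const_smul _
  have hsum : ∑' jk : ℕ × ℕ, (if jk.1 = jk.2 then ((c jk.1 * c jk.2 * (2 * Real.pi) : ℝ) : ℂ)
      else 0) = ((2 * Real.pi * ∑' k, (c k) ^ 2 : ℝ) : ℂ) := by
    rw [Summable.tsum_prod]
    · have hdiag : ∀ b : ℕ, ∑' k : ℕ, (if b = k then ((c b * c k * (2 * Real.pi) : ℝ) : ℂ) else 0) =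
          ((c b * c b * (2 * Real.pi) : ℝ) : ℂ) := fun b => by
        rw [tsum_eq_single b fun k hk => if_neg hk.symm, if_pos rfl]
      simp only [hdiag]
      rw [← Complex.ofReal_tsum, ← tsum_mul_left]
      congr 1
      congr 1 with k
      ring
    · refine Summable.of_norm_bounded (hcs.mul_right (2 * Real.pi)) fun jk => ?_
      split_ifs
      · rw [Complex.norm_real, norm_mul, norm_mul, Real.norm_of_nonneg (by positivity : (0:ℝ) ≤ 2 * Real.pi)]
      · rw [norm_zero]; positivity
  apply Complex.ofReal_injective
  rw [← intervalIntegral.integral_ofReal]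
  simp only [hpt]
  rw [← key]
  simp only [hint]
  exact hsum

/-- The squared Frobenius norms of the spectral components. -/
noncomputable def frobSq {α β : Type} [Fintype α] [Fintype β]
    (G : TransferMatrix α β) (k : ℕ) : ℝ :=
  ∑ i, ∑ j, (spectralComponent G k i j) ^ 2

theorem frobSq_nonneg {α β : Type} [Fintype α] [Fintype β]
    (G : TransferMatrix α β) (k : ℕ) : 0 ≤ frobSq G k :=
  Finset.sum_nonneg fun _ _ => Finset.sum_nonneg fun _ _ => sq_nonneg _

theorem freqResponse_eq_psEval {α β : Type} {G : TransferMatrix α β} (hG : IsRHinf G) (θ : ℝ)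
    (i : α) (j : β) : freqResponse G θ i j =
      psEval (expansionAtInfinity (G i j)) (Complex.exp (θ * Complex.I))⁻¹ := by
  rw [psEval_expansion_eq_eval (isRHinf_iff.mp hG i j) (Complex.norm_exp_ofReal_mul_I θ).ge]
  rfl

theorem summable_frobSq {α β : Type} [Fintype α] [Fintype β]
    {G : TransferMatrix α β} (hG : IsRHinf G) : Summable (frobSq G) :=
  summable_sum fun i _ => summable_sum fun j _ =>
    (absSummable_expansionAtInfinity (isRHinf_iff.mp hG i j)).summable_sq

theorem isRHinf_of_summable_frobSq {α β : Type} [Fintype α] [Fintype β]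
    {G : TransferMatrix α β} (hG : IsProper G) (h : Summable (frobSq G)) : IsRHinf G := by
  rw [isRHinf_iff]
  refine fun i j => mem_stableSubring_of_summable_sq (hG i j) ?_
  refine Summable.of_nonneg_of_le (fun _ => sq_nonneg _) (fun k => ?_) h
  have h1 : (spectralComponent G k i j) ^ 2 ≤ ∑ j, (spectralComponent G k i j) ^ 2 :=
    Finset.single_le_sum (f := fun j => (spectralComponent G k i j) ^ 2)
      (fun _ _ => sq_nonneg _) (Finset.mem_univ j)
  have h2 : ∑ j, (spectralComponent G k i j) ^ 2 ≤ frobSq G k :=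
    Finset.single_le_sum (f := fun i => ∑ j, (spectralComponent G k i j) ^ 2)
      (fun _ _ => Finset.sum_nonneg fun _ _ => sq_nonneg _) (Finset.mem_univ i)
  exact h1.trans h2

theorem h2Norm_sq_eq_tsum {α β : Type} [Fintype α] [Fintype β]
    {G : TransferMatrix α β} (hG : IsRHinf G) :
    h2Norm G ^ 2 = ENNReal.ofReal (∑' k, frobSq G k) := by
  have hle : -Real.pi ≤ Real.pi := by linarith [Real.pi_pos]
  have habs := fun i j => absSummable_expansionAtInfinity (isRHinf_iff.mp hG i j)
  have hcont : ∀ i j, Continuous fun θ : ℝ => ‖freqResponse G θ i j‖ ^ 2 := fun i j => by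
    simp only [freqResponse_eq_psEval hG]
    exact (habs i j).continuous_psEval_circle.norm.pow 2
  have hreal : ∫ θ in Set.Icc (-Real.pi) Real.pi, ∑ i, ∑ j, ‖freqResponse G θ i j‖ ^ 2 =
      2 * Real.pi * ∑' k, frobSq G k := by
    rw [MeasureTheory.integral_Icc_eq_integral_Ioc, ← intervalIntegral.integral_of_le hle,
      intervalIntegral.integral_finsetSum fun i _ => Continuous.intervalIntegrable
        (continuous_finsetSum _ fun j _ => hcont i j) _ _]
    have hS : ∀ i j, Summable fun k => spectralComponent G k i j ^ 2 :=
      fun i j => (habs i j).summable_sq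
    simp only [frobSq]
    rw [Summable.tsum_finsetSum fun i _ => summable_sum fun j _ => hS i j,
      Finset.mul_sum]
    refine Finset.sum_congr rfl fun i _ => ?_
    rw [intervalIntegral.integral_finsetSum fun j _ => (hcont i j).intervalIntegrable _ _,
      Summable.tsum_finsetSum fun j _ => hS i j, Finset.mul_sum]
    refine Finset.sum_congr rfl fun j _ => ?_
    simp only [freqResponse_eq_psEval hG]
    exact (habs i j).integral_norm_sq
  have hlint : ∫⁻ θ in Set.Icc (-Real.pi) Real.pi,
      ENNReal.ofReal (∑ i, ∑ j, ‖freqResponse G θ i j‖ ^ 2) =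
      ENNReal.ofReal (2 * Real.pi * ∑' k, frobSq G k) := by
    rw [← hreal, MeasureTheory.ofReal_integral_eq_lintegral_ofReal]
    · exact (continuous_finsetSum _ fun i _ => continuous_finsetSum _ fun j _ =>
        hcont i j).continuousOn.integrableOn_compact isCompact_Icc
    · exact Filter.Eventually.of_forall fun θ => by positivity
  rw [h2Norm, hlint, ← ENNReal.ofReal_mul (by positivity), ← ENNReal.rpow_natCast,
    ← ENNReal.rpow_mul]
  have : (1 / 2 : ℝ) * (2 : ℕ) = 1 := by norm_num
  rw [this, ENNReal.rpow_one]
  congr 1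
  have := Real.pi_pos
  field_simp

/-! ### Matrices with entries in a subring of the rational functions -/

section MatIn

variable {α β γ δ : Type} {S : Subring (RatFunc ℝ)}

/-- All entries of the matrix lie in the subring. -/
def MatIn (S : Subring (RatFunc ℝ)) (G : TransferMatrix α β) : Prop := ∀ i j, G i j ∈ S

theorem MatIn.add {G H : TransferMatrix α β} (hG : MatIn S G) (hH : MatIn S H) :
    MatIn S (G + H) := fun i j => add_mem (hG i j) (hH i j)

theorem MatIn.sub {G H : TransferMatrix α β} (hG : MatIn S G) (hH : MatIn S H) :
    MatIn S (G - H) := fun i j => sub_mem (hG i j) (hH i j)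

theorem MatIn.neg {G : TransferMatrix α β} (hG : MatIn S G) : MatIn S (-G) :=
  fun i j => neg_mem (hG i j)

theorem MatIn.zero : MatIn S (0 : TransferMatrix α β) := fun _ _ => zero_mem S

theorem MatIn.one [DecidableEq α] : MatIn S (1 : TransferMatrix α α) := fun i j => by
  rw [Matrix.one_apply]
  split_ifs
  exacts [one_mem S, zero_mem S]

theorem MatIn.mul [Fintype β] {G : TransferMatrix α β} {H : TransferMatrix β γ}
    (hG : MatIn S G) (hH : MatIn S H) : MatIn S (G * H) := fun i j => by
  rw [Matrix.mul_apply]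
  exact sum_mem fun k _ => mul_mem (hG i k) (hH k j)

theorem MatIn.fromBlocks {A : TransferMatrix α γ} {B : TransferMatrix α δ}
    {C : TransferMatrix β γ} {D : TransferMatrix β δ} (hA : MatIn S A) (hB : MatIn S B)
    (hC : MatIn S C) (hD : MatIn S D) : MatIn S (Matrix.fromBlocks A B C D) := by
  rintro (i | i) (j | j)
  exacts [hA i j, hB i j, hC i j, hD i j]

theorem matIn_fromBlocks_iff {A : TransferMatrix α γ} {B : TransferMatrix α δ}
    {C : TransferMatrix β γ} {D : TransferMatrix β δ} :
    MatIn S (Matrix.fromBlocks A B C D) ↔ MatIn S A ∧ MatIn S B ∧ MatIn S C ∧ MatIn S D :=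
  ⟨fun h => ⟨fun i j => h (.inl i) (.inl j), fun i j => h (.inl i) (.inr j),
    fun i j => h (.inr i) (.inl j), fun i j => h (.inr i) (.inr j)⟩,
    fun h => h.1.fromBlocks h.2.1 h.2.2.1 h.2.2.2⟩

/-- The matrix over the subring. -/
def MatIn.lift {G : TransferMatrix α β} (hG : MatIn S G) : Matrix α β S :=
  Matrix.of fun i j => ⟨G i j, hG i j⟩

variable [Fintype α] [DecidableEq α]

theorem MatIn.det_lift {G : TransferMatrix α α} (hG : MatIn S G) :
    (hG.lift.det : RatFunc ℝ) = G.det :=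
  RingHom.map_det S.subtype hG.lift

theorem MatIn.det_mem {G : TransferMatrix α α} (hG : MatIn S G) : G.det ∈ S := by
  rw [← hG.det_lift]; exact hG.lift.det.2

theorem MatIn.adjugate {G : TransferMatrix α α} (hG : MatIn S G) : MatIn S G.adjugate :=
  fun i j => by
    have : S.subtype.mapMatrix hG.lift.adjugate = G.adjugate :=
      RingHom.map_adjugate S.subtype hG.lift
    rw [← this]
    exact (hG.lift.adjugate i j).2

/-- Cramer's rule: the adjugate stays in the subring, so only the inverse of the determinant
matters. -/
theorem MatIn.inv {G : TransferMatrix α α} (hG : MatIn S G) (hd : G.det⁻¹ ∈ S) :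
    MatIn S G⁻¹ := fun i j => by
  rw [Matrix.inv_def, Ring.inverse_eq_inv', Matrix.smul_apply, smul_eq_mul]
  exact mul_mem hd (hG.adjugate i j)

end MatIn

theorem isRHinf_iff_matIn {α β : Type} {G : TransferMatrix α β} :
    IsRHinf G ↔ MatIn stableSubring G := isRHinf_iff

/-! ### Expansions of proper transfer matrices -/

/-- The matrix of expansions at infinity. -/
noncomputable def expandMat {α β : Type} (G : TransferMatrix α β) :
    Matrix α β (PowerSeries ℝ) := G.map expansionAtInfinity

theorem expandMat_mul {α β γ : Type} [Fintype β] {G : TransferMatrix α β}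
    {H : TransferMatrix β γ} (hG : IsProper G) (hH : IsProper H) :
    expandMat (G * H) = expandMat G * expandMat H := by
  ext1 i j
  have h : expansionAtInfinity ((G * H) i j) =
      expandHom (∑ k, ⟨G i k, hG i k⟩ * ⟨H k j, hH k j⟩) := by
    rw [expandHom_apply]
    congr 1
    simp [Matrix.mul_apply]
  rw [expandMat, Matrix.map_apply, h, map_sum, Matrix.mul_apply]
  exact Finset.sum_congr rfl fun k _ => map_mul expandHom _ _

theorem expandMat_one {α : Type} [DecidableEq α] :
    expandMat (1 : TransferMatrix α α) = 1 :=
  Matrix.map_one _ expansionAtInfinity_zero expansionAtInfinity_one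

theorem expandMat_neg {α β : Type} {G : TransferMatrix α β} (hG : IsProper G) :
    expandMat (-G) = -expandMat G := by
  ext1 i j
  have h : expansionAtInfinity (-G i j) = expandHom (-⟨G i j, hG i j⟩) := by
    rw [expandHom_apply, Subring.coe_neg]
  rw [expandMat, Matrix.map_apply, Matrix.neg_apply, Matrix.neg_apply, h, map_neg]
  rfl

theorem det_expandMat {α : Type} [Fintype α] [DecidableEq α] {G : TransferMatrix α α}
    (hG : IsProper G) : (expandMat G).det = expansionAtInfinity G.det := by
  have hG' : MatIn properSubring G := hG
  rw [← hG'.det_lift, ← expandHom_apply, RingHom.map_det]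
  rfl

/-! ### The closed loop and its well-posedness -/

section Loop

variable {p m : ℕ} {G : TransferMatrix (Fin p) (Fin m)} {K : TransferMatrix (Fin m) (Fin p)}

/-- The matrix of the feedback equations. -/
noncomputable def loopMatrix (G : TransferMatrix (Fin p) (Fin m))
    (K : TransferMatrix (Fin m) (Fin p)) : TransferMatrix (Fin p ⊕ Fin m) (Fin p ⊕ Fin m) :=
  Matrix.fromBlocks 1 (-G) (-K) 1

theorem det_loopMatrix : (loopMatrix G K).det = (1 - G * K).det := by
  rw [loopMatrix, Matrix.det_fromBlocks_one₂₂]; simp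

theorem isUnit_det_comm :
    IsUnit (1 - K * G).det ↔ IsUnit (1 - G * K).det := by
  rw [Matrix.det_one_sub_mul_comm]

theorem isProper_loopMatrix (hG : IsProper G) (hK : IsProper K) : IsProper (loopMatrix G K) :=
  MatIn.fromBlocks (S := properSubring) MatIn.one (MatIn.neg hG) (MatIn.neg hK) MatIn.one

theorem loopMatrix_mul_block (h : IsUnit (1 - G * K).det) :
    loopMatrix G K * (closedLoop G K).block = 1 := by
  have h' : IsUnit (1 - K * G).det := isUnit_det_comm.mpr h
  have hY : (1 - G * K) * (1 - G * K)⁻¹ = 1 := Matrix.mul_nonsing_inv _ h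
  have hY' : (1 - G * K)⁻¹ * (1 - G * K) = 1 := Matrix.nonsing_inv_mul _ h
  have hZ : (1 - K * G) * (1 - K * G)⁻¹ = 1 := Matrix.mul_nonsing_inv _ h'
  -- The push-through identity.
  have hW : (1 - G * K)⁻¹ * G = G * (1 - K * G)⁻¹ := by
    have h1 : G * (1 - K * G) = (1 - G * K) * G := by
      rw [Matrix.mul_sub, Matrix.sub_mul, Matrix.mul_one, Matrix.one_mul, Matrix.mul_assoc]
    calc (1 - G * K)⁻¹ * G = (1 - G * K)⁻¹ * (G * (1 - K * G)) * (1 - K * G)⁻¹ := by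
          rw [Matrix.mul_assoc, Matrix.mul_assoc, hZ, Matrix.mul_one]
      _ = G * (1 - K * G)⁻¹ := by rw [h1, ← Matrix.mul_assoc, hY', Matrix.one_mul]
  rw [loopMatrix, Responses.block, closedLoop, Matrix.fromBlocks_multiply]
  simp only [Matrix.one_mul, Matrix.neg_mul, ← sub_eq_add_neg]
  rw [← Matrix.fromBlocks_one]
  congr 1
  · rw [← Matrix.mul_assoc]
    nth_rewrite 1 [← Matrix.one_mul (1 - G * K)⁻¹]
    rw [← Matrix.sub_mul, hY]
  · rw [hW, sub_self]
  · rw [neg_add_cancel]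
  · rw [hW, ← Matrix.mul_assoc, neg_add_eq_sub]
    nth_rewrite 1 [← Matrix.one_mul (1 - K * G)⁻¹]
    rw [← Matrix.sub_mul, hZ]

theorem block_eq_inv_loopMatrix (h : IsUnit (1 - G * K).det) :
    (closedLoop G K).block = (loopMatrix G K)⁻¹ :=
  (Matrix.inv_eq_right_inv (loopMatrix_mul_block h)).symm

/-- The generating function of a pair of signals. -/
noncomputable def signalSeries (y : ℕ → Fin p → ℝ) (u : ℕ → Fin m → ℝ) :
    Fin p ⊕ Fin m → PowerSeries ℝ :=
  fun i => PowerSeries.mk fun t => Sum.elim (y t) (u t) i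

theorem coeff_mulVec_signal {α β : Type} [Fintype β] (G : TransferMatrix α β)
    (u : ℕ → β → ℝ) (t : ℕ) (i : α) :
    PowerSeries.coeff t ((expandMat G).mulVec (fun j => PowerSeries.mk fun t => u t j) i) =
      ∑ k ∈ Finset.range (t + 1), (spectralComponent G k).mulVec (u (t - k)) i := by
  simp only [Matrix.mulVec, dotProduct, map_sum, PowerSeries.coeff_mul, PowerSeries.coeff_mk]
  conv_rhs => rw [Finset.sum_comm]
  refine Finset.sum_congr rfl fun j _ => ?_
  rw [Finset.Nat.sum_antidiagonal_eq_sum_range_succ_mk]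
  rfl

/-- Causal convolution is multiplication of generating functions, so the recursion in time is a
square linear system over `ℝ⟦X⟧`. -/
theorem loopEq_iff (hG : IsProper G) (hK : IsProper K) (v y : ℕ → Fin p → ℝ)
    (w u : ℕ → Fin m → ℝ) :
    LoopEq G K v w y u ↔
      (expandMat (loopMatrix G K)).mulVec (signalSeries y u) = signalSeries v w := by
  have hblock : expandMat (loopMatrix G K) =
      Matrix.fromBlocks 1 (-expandMat G) (-expandMat K) 1 := by
    rw [← expandMat_neg hG, ← expandMat_neg hK, expandMat, loopMatrix, Matrix.fromBlocks_map,
      ← expandMat_one, ← expandMat_one]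
    rfl
  have hsig : ∀ (a : ℕ → Fin p → ℝ) (b : ℕ → Fin m → ℝ), signalSeries a b =
      Sum.elim (fun i => PowerSeries.mk fun t => a t i) (fun j => PowerSeries.mk fun t => b t j) := by
    intro a b
    ext1 (i | i) <;> rfl
  rw [hblock, hsig, hsig, Matrix.fromBlocks_mulVec]
  constructor
  · intro h
    ext1 (i | i)
    · ext t
      have := congrFun (h t).1 i
      simp only [Sum.elim_inl, Sum.elim_comp_inl, Sum.elim_comp_inr, Matrix.one_mulVec,
        Matrix.neg_mulVec, Pi.add_apply, Pi.neg_apply, map_add, map_neg, coeff_mulVec_signal,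
        PowerSeries.coeff_mk]
      rw [this]
      simp
    · ext t
      have := congrFun (h t).2 i
      simp only [Sum.elim_inr, Sum.elim_comp_inl, Sum.elim_comp_inr, Matrix.one_mulVec,
        Matrix.neg_mulVec, Pi.add_apply, Pi.neg_apply, map_add, map_neg, coeff_mulVec_signal,
        PowerSeries.coeff_mk]
      rw [this]
      simp
  · intro h t
    constructor
    · ext i
      have := congrArg (PowerSeries.coeff t) (congrFun h (.inl i))
      simp only [Sum.elim_inl, Sum.elim_comp_inl, Sum.elim_comp_inr, Matrix.one_mulVec,
        Matrix.neg_mulVec, Pi.add_apply, Pi.neg_apply, map_add, map_neg, coeff_mulVec_signal,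
        PowerSeries.coeff_mk] at this
      rw [Pi.add_apply, Finset.sum_apply]
      linarith
    · ext i
      have := congrArg (PowerSeries.coeff t) (congrFun h (.inr i))
      simp only [Sum.elim_inr, Sum.elim_comp_inl, Sum.elim_comp_inr, Matrix.one_mulVec,
        Matrix.neg_mulVec, Pi.add_apply, Pi.neg_apply, map_add, map_neg, coeff_mulVec_signal,
        PowerSeries.coeff_mk] at this
      rw [Pi.add_apply, Finset.sum_apply]
      linarith

/-- Every family of power series is the generating function of a pair of signals. -/
theorem exists_signalSeries (f : Fin p ⊕ Fin m → PowerSeries ℝ) :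
    ∃ (y : ℕ → Fin p → ℝ) (u : ℕ → Fin m → ℝ), signalSeries y u = f :=
  ⟨fun t i => PowerSeries.coeff t (f (.inl i)), fun t j => PowerSeries.coeff t (f (.inr j)), by
    ext1 (i | i) <;> ext t <;> simp [signalSeries]⟩

theorem signalSeries_injective {y y' : ℕ → Fin p → ℝ} {u u' : ℕ → Fin m → ℝ}
    (h : signalSeries y u = signalSeries y' u') : y = y' ∧ u = u' := by
  constructor
  · ext t i
    simpa [signalSeries] using congrArg (PowerSeries.coeff t) (congrFun h (.inl i))
  · ext t i
    simpa [signalSeries] using congrArg (PowerSeries.coeff t) (congrFun h (.inr i))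

theorem expandMat_block_mul (hG : IsProper G) (hK : IsProper K) (h : IsUnit (1 - G * K).det)
    (hb : IsProper (closedLoop G K).block) :
    expandMat (closedLoop G K).block * expandMat (loopMatrix G K) = 1 := by
  rw [← expandMat_mul hb (isProper_loopMatrix hG hK),
    mul_eq_one_comm.mp (loopMatrix_mul_block h), expandMat_one]

/-- Solvability for every noise makes the loop matrix surjective over `ℝ⟦X⟧`, hence invertible,
being square. Its determinant is then a unit, so has nonzero constant term, and the rational
determinant has a proper inverse. Conversely, a proper closed loop expands to a two-sided inverse of
the loop matrix. -/
theorem wellPosed_iff (hG : IsProper G) (hK : IsProper K) :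
    WellPosed G K ↔ IsUnit (1 - G * K).det ∧ IsProper (closedLoop G K).block := by
  constructor
  · intro hw
    have hsurj : Function.Surjective (expandMat (loopMatrix G K)).mulVec := by
      intro f
      obtain ⟨v, w, rfl⟩ := exists_signalSeries f
      obtain ⟨yu, hyu, -⟩ := hw v w
      exact ⟨signalSeries yu.1 yu.2, (loopEq_iff hG hK _ _ _ _).mp hyu⟩
    obtain ⟨B, hB⟩ := Matrix.mulVec_surjective_iff_exists_right_inverse.mp hsurj
    have hA := isProper_loopMatrix hG hK
    have hu := Matrix.isUnit_det_of_right_inverse hB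
    rw [det_expandMat hA] at hu
    have hc := (hu.map PowerSeries.constantCoeff).ne_zero
    have hinv := inv_mem_properSubring hc
    have hd : IsUnit (loopMatrix G K).det := by
      rw [isUnit_iff_ne_zero]
      intro h0
      rw [h0, expansionAtInfinity_zero, map_zero] at hc
      exact hc rfl
    rw [det_loopMatrix] at hd
    refine ⟨hd, ?_⟩
    rw [block_eq_inv_loopMatrix hd]
    exact MatIn.inv (S := properSubring) hA hinv
  · rintro ⟨hd, hb⟩ v w
    have h1 := expandMat_block_mul hG hK hd hb
    have h2 := mul_eq_one_comm.mp h1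
    obtain ⟨y, u, hyu⟩ := exists_signalSeries
      ((expandMat (closedLoop G K).block).mulVec (signalSeries v w))
    refine ⟨(y, u), ?_, ?_⟩
    · change LoopEq G K v w y u
      rw [loopEq_iff hG hK, hyu, Matrix.mulVec_mulVec, h2, Matrix.one_mulVec]
    · rintro ⟨y', u'⟩ h'
      change LoopEq G K v w y' u' at h'
      rw [loopEq_iff hG hK] at h'
      have : signalSeries y' u' = signalSeries y u := by
        rw [hyu, ← h', Matrix.mulVec_mulVec, h1, Matrix.one_mulVec]
      obtain ⟨h3, h4⟩ := signalSeries_injective this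
      rw [h3, h4]

/-- The signals of a well-posed loop are the convolution of the noise with the impulse response
of the closed loop. -/
theorem loopEq_signal (hG : IsProper G) (hK : IsProper K) (hw : WellPosed G K)
    {v y : ℕ → Fin p → ℝ} {w u : ℕ → Fin m → ℝ} (h : LoopEq G K v w y u) (t : ℕ)
    (i : Fin p ⊕ Fin m) :
    Sum.elim (y t) (u t) i = ∑ k ∈ Finset.range (t + 1),
      (spectralComponent (closedLoop G K).block k).mulVec
        (Sum.elim (v (t - k)) (w (t - k))) i := by
  obtain ⟨hd, hb⟩ := (wellPosed_iff hG hK).mp hw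
  have h1 := (loopEq_iff hG hK _ _ _ _).mp h
  have h2 : signalSeries y u =
      (expandMat (closedLoop G K).block).mulVec (signalSeries v w) := by
    rw [← h1, Matrix.mulVec_mulVec, expandMat_block_mul hG hK hd hb, Matrix.one_mulVec]
  have h3 := congrArg (PowerSeries.coeff t) (congrFun h2 i)
  have h4 := coeff_mulVec_signal (closedLoop G K).block (fun t => Sum.elim (v t) (w t)) t i
  have h5 : signalSeries v w =
      fun j => PowerSeries.mk fun t => Sum.elim (v t) (w t) j := rfl
  rw [← h4, ← h5, ← h3]
  simp [signalSeries]

end Loop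

open MeasureTheory ProbabilityTheory Filter

/-! ### Cesàro means of partial sums of nonnegative series -/

theorem tendsto_cesaro_partialSums_of_summable {f : ℕ → ℝ} (hf : Summable f) :
    Tendsto (fun T : ℕ => (1 / (T : ℝ)) * ∑ t ∈ Finset.range (T + 1),
      ∑ k ∈ Finset.range (t + 1), f k) atTop (nhds (∑' k, f k)) := by
  have hs : Tendsto (fun t : ℕ => ∑ k ∈ Finset.range (t + 1), f k) atTop (nhds (∑' k, f k)) :=
    (tendsto_add_atTop_iff_nat 1).mpr hf.hasSum.tendsto_sum_nat
  have h1 := hs.cesaro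
  have h2 := (tendsto_inv_atTop_nhds_zero_nat (𝕜 := ℝ)).mul hs
  -- The average divides `T + 1` terms by `T`; the surplus term is a convergent sequence divided by
  -- `T`.
  have h3 := h1.add h2
  rw [zero_mul, add_zero] at h3
  refine h3.congr fun T => ?_
  rw [Finset.sum_range_succ (fun t => ∑ k ∈ Finset.range (t + 1), f k) T, one_div, mul_add]

theorem tendsto_cesaro_partialSums_of_not_summable {f : ℕ → ℝ} (h0 : ∀ k, 0 ≤ f k)
    (hf : ¬ Summable f) :
    Tendsto (fun T : ℕ => (1 / (T : ℝ)) * ∑ t ∈ Finset.range (T + 1),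
      ∑ k ∈ Finset.range (t + 1), f k) atTop atTop := by
  have hs : Tendsto (fun t : ℕ => ∑ k ∈ Finset.range (t + 1), f k) atTop atTop :=
    (tendsto_add_atTop_iff_nat 1).mpr ((not_summable_iff_tendsto_nat_atTop_of_nonneg h0).mp hf)
  have hs0 : ∀ t : ℕ, 0 ≤ ∑ k ∈ Finset.range (t + 1), f k :=
    fun t => Finset.sum_nonneg fun k _ => h0 k
  refine tendsto_atTop.mpr fun M => ?_
  -- Beyond `N` the partial sums exceed `2 * |M|`, and for `T ≥ 2 * N + 1` at least `T / 2` of the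
  -- indices lie there; the factor `2` compensates for this half.
  obtain ⟨N, hN⟩ := eventually_atTop.mp (hs.eventually_ge_atTop (2 * |M|))
  filter_upwards [eventually_ge_atTop (2 * N + 1)] with T hT
  have hT0 : (0 : ℝ) < T := by exact_mod_cast (by omega : 0 < T)
  have h1 : ∑ t ∈ Finset.Ico N (T + 1), (2 * |M|) ≤
      ∑ t ∈ Finset.Ico N (T + 1), ∑ k ∈ Finset.range (t + 1), f k :=
    Finset.sum_le_sum fun t ht => hN t (Finset.mem_Ico.mp ht).1
  have h2 : ∑ t ∈ Finset.Ico N (T + 1), ∑ k ∈ Finset.range (t + 1), f k ≤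
      ∑ t ∈ Finset.range (T + 1), ∑ k ∈ Finset.range (t + 1), f k := by
    refine Finset.sum_le_sum_of_subset_of_nonneg ?_ fun t _ _ => hs0 t
    rw [Finset.range_eq_Ico]
    exact Finset.Ico_subset_Ico (Nat.zero_le _) le_rfl
  rw [Finset.sum_const, Nat.card_Ico, nsmul_eq_mul] at h1
  have h3 : ((T + 1 - N : ℕ) : ℝ) ≥ T / 2 := by
    rw [Nat.cast_sub (by omega)]
    have : (2 * N + 1 : ℝ) ≤ T := by exact_mod_cast hT
    push_cast
    linarith
  rw [one_div, ← div_eq_inv_mul, le_div_iff₀ hT0]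
  have h4 : T / 2 * (2 * |M|) ≤ ((T + 1 - N : ℕ) : ℝ) * (2 * |M|) :=
    mul_le_mul_of_nonneg_right h3 (by positivity)
  have h5 : M * T ≤ |M| * T := mul_le_mul_of_nonneg_right (le_abs_self M) hT0.le
  linarith

theorem tendsto_ofReal_cesaro_partialSums {f : ℕ → ℝ} (h0 : ∀ k, 0 ≤ f k) :
    Tendsto (fun T : ℕ => ENNReal.ofReal ((1 / (T : ℝ)) * ∑ t ∈ Finset.range (T + 1),
      ∑ k ∈ Finset.range (t + 1), f k)) atTop (nhds (∑' k, ENNReal.ofReal (f k))) := by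
  by_cases hf : Summable f
  · rw [← ENNReal.ofReal_tsum_of_nonneg h0 hf]
    exact (ENNReal.continuous_ofReal.tendsto _).comp (tendsto_cesaro_partialSums_of_summable hf)
  · have : ∑' k, ENNReal.ofReal (f k) = ⊤ := by
      by_contra hne
      refine hf ?_
      have := ENNReal.summable_toReal hne
      simpa only [ENNReal.toReal_ofReal (h0 _)] using this
    rw [this]
    exact ENNReal.tendsto_ofReal_atTop.comp (tendsto_cesaro_partialSums_of_not_summable h0 hf)

/-! ### Second moments of filtered white noise -/

section Noise

variable {p m : ℕ} {Ω : Type*} [MeasurableSpace Ω] {P : Measure Ω}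
  {v : ℕ → Ω → Fin p → ℝ} {w : ℕ → Ω → Fin m → ℝ}

theorem IsWhiteNoise.hasLaw (hvw : IsWhiteNoise P v w) (t : ℕ) (i : Fin p ⊕ Fin m) :
    HasLaw (fun ω => Sum.elim (v t ω) (w t ω) i) (gaussianReal 0 1) P := by
  rcases i with i | i
  exacts [hvw.law_v t i, hvw.law_w t i]

theorem IsWhiteNoise.memLp (hvw : IsWhiteNoise P v w) (t : ℕ) (i : Fin p ⊕ Fin m) :
    MemLp (fun ω => Sum.elim (v t ω) (w t ω) i) 2 P := by
  have h := hvw.hasLaw t i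
  have h2 : MemLp (id : ℝ → ℝ) 2 (Measure.map (fun ω => Sum.elim (v t ω) (w t ω) i) P) := by
    rw [h.map_eq]
    exact memLp_id_gaussianReal 2
  exact h2.comp_of_map h.aemeasurable

variable [IsProbabilityMeasure P]

/-- The output at one time of the convolution of white noise with a kernel. -/
theorem IsWhiteNoise.filtered (hvw : IsWhiteNoise P v w) (h : ℕ → Fin p ⊕ Fin m → ℝ) (t : ℕ) :
    MemLp (fun ω => ∑ k ∈ Finset.range (t + 1),
      ∑ j, h k j * Sum.elim (v (t - k) ω) (w (t - k) ω) j) 2 P ∧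
    ∫ ω, (∑ k ∈ Finset.range (t + 1),
      ∑ j, h k j * Sum.elim (v (t - k) ω) (w (t - k) ω) j) ^ 2 ∂P =
      ∑ k ∈ Finset.range (t + 1), ∑ j, (h k j) ^ 2 := by
  let s : Finset (ℕ × (Fin p ⊕ Fin m)) := Finset.range (t + 1) ×ˢ Finset.univ
  let Y : ℕ × (Fin p ⊕ Fin m) → Ω → ℝ := fun a ω =>
    h a.1 a.2 * Sum.elim (v (t - a.1) ω) (w (t - a.1) ω) a.2
  have hY : ∀ a, MemLp (Y a) 2 P := fun a => (hvw.memLp (t - a.1) a.2).const_mul _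
  have hsum : (fun ω => ∑ k ∈ Finset.range (t + 1),
      ∑ j, h k j * Sum.elim (v (t - k) ω) (w (t - k) ω) j) = ∑ a ∈ s, Y a := by
    ext ω
    rw [Finset.sum_apply, Finset.sum_product]
  have hmem : MemLp (∑ a ∈ s, Y a) 2 P := memLp_finsetSum' s fun a _ => hY a
  have hYint : ∀ a, ∫ ω, Y a ω ∂P = 0 := fun a => by
    simp only [Y]
    rw [integral_const_mul, (hvw.hasLaw _ _).integral_eq, integral_id_gaussianReal, mul_zero]
  have hYvar : ∀ a, Var[Y a; P] = (h a.1 a.2) ^ 2 := fun a => by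
    simp only [Y]
    rw [variance_const_mul, (hvw.hasLaw _ _).variance_eq, variance_id_gaussianReal]
    simp
  have hmean : ∫ ω, (∑ a ∈ s, Y a) ω ∂P = 0 := by
    simp only [Finset.sum_apply]
    rw [integral_finsetSum _ fun a _ => (hY a).integrable (by norm_num)]
    simp [hYint]
  have hindep : (s : Set _).Pairwise fun a b => IndepFun (Y a) (Y b) P := by
    rintro ⟨k, j⟩ ha ⟨k', j'⟩ hb hab
    have hk : k < t + 1 := by
      simpa [s] using ha
    have hk' : k' < t + 1 := by
      simpa [s] using hb
    -- Truncated subtraction is injective here because `k` and `k'` are at most `t`; distinct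
    -- indices therefore pick independent noise coordinates.
    have hne : (t - k, j) ≠ (t - k', j') := by
      intro h
      rw [Prod.mk.injEq] at h
      exact hab (Prod.ext (by simp only; omega) h.2)
    exact (hvw.indep.indepFun hne).comp (measurable_const_mul (h k j))
      (measurable_const_mul (h k' j'))
  -- Variances add by pairwise independence, and the zero mean turns the variance of the sum into
  -- its second moment.
  have hvar := IndepFun.variance_sum (fun a _ => hY a) hindep
  rw [variance_of_integral_eq_zero hmem.aemeasurable hmean] at hvar
  rw [hsum]
  refine ⟨hmem, ?_⟩
  have h1 : ∀ ω, (∑ k ∈ Finset.range (t + 1),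
      ∑ j, h k j * Sum.elim (v (t - k) ω) (w (t - k) ω) j) = (∑ a ∈ s, Y a) ω :=
    fun ω => congrFun hsum ω
  simp only [h1]
  rw [hvar, Finset.sum_product]
  simp only [hYvar]

variable {G : TransferMatrix (Fin p) (Fin m)} {K : TransferMatrix (Fin m) (Fin p)}

theorem avgCost_eq (hvw : IsWhiteNoise P v w) (hG : IsProper G) (hK : IsProper K)
    (hw : WellPosed G K) {y : ℕ → Ω → Fin p → ℝ} {u : ℕ → Ω → Fin m → ℝ}
    (h : ∀ ω, LoopEq G K (fun t => v t ω) (fun t => w t ω) (fun t => y t ω) (fun t => u t ω))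
    (T : ℕ) :
    avgCost P y u T = ENNReal.ofReal ((1 / (T : ℝ)) * ∑ t ∈ Finset.range (T + 1),
      ∑ k ∈ Finset.range (t + 1), frobSq (closedLoop G K).block k) := by
  set H := (closedLoop G K).block with hH
  have hpt : ∀ ω t, dotProduct (y t ω) (y t ω) + dotProduct (u t ω) (u t ω) =
      ∑ i, (∑ k ∈ Finset.range (t + 1), ∑ j, spectralComponent H k i j *
        Sum.elim (v (t - k) ω) (w (t - k) ω) j) ^ 2 := by
    intro ω t
    have h1 : ∀ i, ∑ k ∈ Finset.range (t + 1), ∑ j, spectralComponent H k i j *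
        Sum.elim (v (t - k) ω) (w (t - k) ω) j = Sum.elim (y t ω) (u t ω) i :=
      fun i => (loopEq_signal hG hK hw (h ω) t i).symm
    simp only [h1]
    rw [Fintype.sum_sum_type]
    simp [dotProduct, sq]
  have hF := fun (i : Fin p ⊕ Fin m) t =>
    hvw.filtered (fun k j => spectralComponent H k i j) t
  have hint : ∀ t, Integrable (fun ω => ∑ i, (∑ k ∈ Finset.range (t + 1),
      ∑ j, spectralComponent H k i j * Sum.elim (v (t - k) ω) (w (t - k) ω) j) ^ 2) P :=
    fun t => integrable_finsetSum _ fun i _ => (hF i t).1.integrable_sq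
  rw [avgCost]
  simp only [hpt]
  rw [← ofReal_integral_eq_lintegral_ofReal]
  · congr 1
    rw [integral_const_mul, integral_finsetSum _ fun t _ => hint t]
    congr 1
    refine Finset.sum_congr rfl fun t _ => ?_
    rw [integral_finsetSum _ fun i _ => (hF i t).1.integrable_sq]
    simp only [frobSq]
    rw [Finset.sum_comm]
    exact Finset.sum_congr rfl fun i _ => (hF i t).2
  · exact (integrable_finsetSum _ fun t _ => hint t).const_mul _
  · exact Eventually.of_forall fun ω => by positivity

theorem tendsto_avgCost (hvw : IsWhiteNoise P v w) (hG : IsProper G) (hK : IsProper K)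
    (hw : WellPosed G K) {y : ℕ → Ω → Fin p → ℝ} {u : ℕ → Ω → Fin m → ℝ}
    (h : ∀ ω, LoopEq G K (fun t => v t ω) (fun t => w t ω) (fun t => y t ω) (fun t => u t ω)) :
    Tendsto (avgCost P y u) atTop
      (nhds (∑' k, ENNReal.ofReal (frobSq (closedLoop G K).block k))) := by
  have := tendsto_ofReal_cesaro_partialSums (frobSq_nonneg (closedLoop G K).block)
  exact this.congr fun T => (avgCost_eq hvw hG hK hw h T).symm

/-- The signals selected in the definition solve the loop, so the limsup there is a limit. -/
theorem lqgCost_eq_tsum (hvw : IsWhiteNoise P v w) (hG : IsProper G) (hK : IsProper K)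
    (hw : WellPosed G K) :
    lqgCost P v w G K = ∑' k, ENNReal.ofReal (frobSq (closedLoop G K).block k) := by
  rw [lqgCost, dif_pos hw]
  exact (tendsto_avgCost hvw hG hK hw fun ω =>
    (hw (fun s => v s ω) (fun s => w s ω)).choose_spec.1).limsup_eq

theorem lqgCost_of_internallyStabilizes (hvw : IsWhiteNoise P v w) (hG : IsProper G)
    (hK : IsProper K) (h : InternallyStabilizes G K) :
    lqgCost P v w G K = h2Norm (closedLoop G K).block ^ 2 := by
  rw [lqgCost_eq_tsum hvw hG hK ((wellPosed_iff hG hK).mpr ⟨h.1, h.2.1⟩), h2Norm_sq_eq_tsum h.2,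
    ENNReal.ofReal_tsum_of_nonneg (frobSq_nonneg _) (summable_frobSq h.2)]

/-- Finite cost gives a proper closed loop with square summable impulse response, and rationality
upgrades this to stability. -/
theorem lqgCost_lt_top_iff (hvw : IsWhiteNoise P v w) (hG : IsProper G) (hK : IsProper K) :
    lqgCost P v w G K < ⊤ ↔ InternallyStabilizes G K := by
  constructor
  · intro h
    have hw : WellPosed G K := by
      by_contra hw
      rw [lqgCost, dif_neg hw] at h
      exact lt_irrefl _ h
    obtain ⟨hd, hb⟩ := (wellPosed_iff hG hK).mp hw
    rw [lqgCost_eq_tsum hvw hG hK hw] at h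
    refine ⟨hd, isRHinf_of_summable_frobSq hb ?_⟩
    have := ENNReal.summable_toReal h.ne
    simpa only [ENNReal.toReal_ofReal (frobSq_nonneg _ _)] using this
  · intro h
    rw [lqgCost_of_internallyStabilizes hvw hG hK h, h2Norm_sq_eq_tsum h.2]
    exact ENNReal.ofReal_lt_top

end Noise

/-! ### Evaluation of stable transfer matrices on the exterior of the unit disc -/

/-- The value of a stable transfer matrix at the point `z = x⁻¹`. -/
noncomputable def discMat {α β : Type} (G : TransferMatrix α β) (x : ℂ) : Matrix α β ℂ :=
  Matrix.of fun i j => psEval (expansionAtInfinity (G i j)) x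

section DiscMat

variable {α β γ : Type}

theorem discMat_inv_exp {G : TransferMatrix α β} (hG : IsRHinf G) (θ : ℝ) :
    discMat G (Complex.exp (θ * Complex.I))⁻¹ = freqResponse G θ := by
  ext1 i j
  exact (freqResponse_eq_psEval hG θ i j).symm

theorem discMat_mul [Fintype β] {G : TransferMatrix α β} {H : TransferMatrix β γ}
    (hG : IsRHinf G) (hH : IsRHinf H) {x : ℂ} (hx : ‖x‖ ≤ 1) :
    discMat (G * H) x = discMat G x * discMat H x := by
  rw [isRHinf_iff_matIn] at hG hH
  ext1 i j
  have h : psEval (expansionAtInfinity ((G * H) i j)) x =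
      discEval x hx (∑ k, ⟨G i k, hG i k⟩ * ⟨H k j, hH k j⟩) := by
    rw [discEval_apply]
    congr 2
    simp [Matrix.mul_apply]
  rw [discMat, Matrix.of_apply, h, map_sum, Matrix.mul_apply]
  exact Finset.sum_congr rfl fun k _ => map_mul (discEval x hx) _ _

theorem discMat_one [DecidableEq α] (x : ℂ) :
    discMat (1 : TransferMatrix α α) x = 1 := by
  ext1 i j
  rw [discMat, Matrix.of_apply, Matrix.one_apply, Matrix.one_apply]
  split_ifs
  · rw [expansionAtInfinity_one, psEval_one]
  · rw [expansionAtInfinity_zero, psEval_zero]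

theorem discMat_add {G H : TransferMatrix α β} (hG : IsRHinf G) (hH : IsRHinf H)
    {x : ℂ} (hx : ‖x‖ ≤ 1) : discMat (G + H) x = discMat G x + discMat H x := by
  rw [isRHinf_iff_matIn] at hG hH
  ext1 i j
  have h : psEval (expansionAtInfinity ((G + H) i j)) x =
      discEval x hx (⟨G i j, hG i j⟩ + ⟨H i j, hH i j⟩) := by
    rw [discEval_apply]
    congr 2
  rw [discMat, Matrix.of_apply, h, map_add]
  rfl

theorem discMat_sub {G H : TransferMatrix α β} (hG : IsRHinf G) (hH : IsRHinf H) {x : ℂ}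
    (hx : ‖x‖ ≤ 1) : discMat (G - H) x = discMat G x - discMat H x := by
  rw [isRHinf_iff_matIn] at hG hH
  ext1 i j
  have h : psEval (expansionAtInfinity ((G - H) i j)) x =
      discEval x hx (⟨G i j, hG i j⟩ - ⟨H i j, hH i j⟩) := by
    rw [discEval_apply]
    congr 2
  rw [discMat, Matrix.of_apply, h, map_sub]
  rfl

theorem psEval_det [Fintype α] [DecidableEq α] {G : TransferMatrix α α} (hG : IsRHinf G) {x : ℂ}
    (hx : ‖x‖ ≤ 1) : psEval (expansionAtInfinity G.det) x = (discMat G x).det := by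
  rw [isRHinf_iff_matIn] at hG
  rw [← hG.det_lift, ← discEval_apply x hx, RingHom.map_det]
  rfl

theorem freqResponse_mul [Fintype β] {G : TransferMatrix α β} {H : TransferMatrix β γ}
    (hG : IsRHinf G) (hH : IsRHinf H) (θ : ℝ) :
    freqResponse (G * H) θ = freqResponse G θ * freqResponse H θ := by
  have hGH : IsRHinf (G * H) := isRHinf_iff_matIn.mpr
    ((isRHinf_iff_matIn.mp hG).mul (isRHinf_iff_matIn.mp hH))
  rw [← discMat_inv_exp hGH, discMat_mul hG hH (norm_inv_exp_mul_I θ).le, discMat_inv_exp hG,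
    discMat_inv_exp hH]

end DiscMat

/-! ### The operator norm and the small gain theorem -/

section SmallGain

open scoped Matrix.Norms.L2Operator

variable {α β : Type} [Fintype α] [Fintype β] [DecidableEq β]

theorem l2_opNorm_le_of_forall {M : Matrix α β ℂ} {c : ℝ} (hc : 0 ≤ c)
    (h : ∀ b : β → ℂ, ‖WithLp.toLp 2 (M.mulVec b)‖ ≤ c * ‖WithLp.toLp 2 b‖) : ‖M‖ ≤ c := by
  rw [Matrix.l2_opNorm_def]
  exact ContinuousLinearMap.opNorm_le_bound _ hc fun x => h x.ofLp

theorem norm_entry_le_l2_opNorm (M : Matrix α β ℂ) (i : α) (j : β) : ‖M i j‖ ≤ ‖M‖ := by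
  have h := Matrix.l2_opNorm_mulVec M (EuclideanSpace.single j 1)
  rw [PiLp.norm_single, norm_one, mul_one] at h
  refine le_trans ?_ h
  refine le_trans (le_of_eq ?_) (PiLp.norm_apply_le _ i)
  simp

/-- Maximum modulus principle for the matrix-valued function `x ↦ G(x⁻¹)`, holomorphic in the open
disc and continuous on its closure. -/
theorem norm_discMat_le {G : TransferMatrix α β} (hG : IsRHinf G) {c : ℝ}
    (h : ∀ θ, ‖freqResponse G θ‖ ≤ c) {x : ℂ} (hx : ‖x‖ ≤ 1) : ‖discMat G x‖ ≤ c := by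
  classical
  have habs := fun i j => absSummable_expansionAtInfinity (isRHinf_iff.mp hG i j)
  have hsum : discMat G = fun x => ∑ i, ∑ j, psEval (expansionAtInfinity (G i j)) x •
      (Matrix.single i j 1 : Matrix α β ℂ) := by
    ext1 x
    rw [Matrix.matrix_eq_sum_single (discMat G x)]
    simp [discMat]
  have hd : DiffContOnCl ℂ (discMat G) (Metric.ball 0 1) := by
    rw [hsum]
    constructor
    · exact DifferentiableOn.fun_sum fun i _ => DifferentiableOn.fun_sum fun j _ =>
        (habs i j).differentiableOn_psEval.smul_const _
    · rw [closure_ball (0 : ℂ) one_ne_zero]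
      exact continuousOn_finsetSum _ fun i _ => continuousOn_finsetSum _ fun j _ =>
        (habs i j).continuous_psEval.smul continuousOn_const
  refine Complex.norm_le_of_forall_mem_frontier_norm_le Metric.isBounded_ball hd (fun z hz => ?_)
    (by rw [closure_ball (0 : ℂ) one_ne_zero]; simpa using hx)
  rw [frontier_ball (0 : ℂ) one_ne_zero, mem_sphere_zero_iff_norm] at hz
  have hz0 : z ≠ 0 := by rintro rfl; simp at hz
  have : z = (Complex.exp ((z⁻¹.arg : ℝ) * Complex.I))⁻¹ := by
    have h1 := Complex.norm_mul_exp_arg_mul_I z⁻¹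
    rw [norm_inv, hz, inv_one, Complex.ofReal_one, one_mul] at h1
    rw [h1, inv_inv]
  rw [this, discMat_inv_exp hG]
  exact h _

/-- A stable transfer matrix of gain smaller than one: `I - M` is invertible over the stable
transfer matrices. -/
theorem inv_det_one_sub_mem {M : TransferMatrix β β} (hM : IsRHinf M) {c : ℝ} (hc : c < 1)
    (h : ∀ θ, ‖freqResponse M θ‖ ≤ c) :
    IsUnit (1 - M).det ∧ (1 - M).det⁻¹ ∈ stableSubring := by
  have h1 : IsRHinf (1 : TransferMatrix β β) := isRHinf_iff_matIn.mpr MatIn.one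
  have h1M : MatIn stableSubring (1 - M) := MatIn.one.sub (isRHinf_iff_matIn.mp hM)
  have hne : ∀ x : ℂ, ‖x‖ ≤ 1 → psEval (expansionAtInfinity (1 - M).det) x ≠ 0 := by
    intro x hx
    rw [psEval_det (isRHinf_iff_matIn.mpr h1M) hx, discMat_sub h1 hM hx, discMat_one]
    -- Neumann series at each point of the closed disc.
    have : IsUnit (1 - discMat M x) :=
      isUnit_one_sub_of_norm_lt_one ((norm_discMat_le hM h hx).trans_lt hc)
    exact ((Matrix.isUnit_iff_isUnit_det _).mp this).ne_zero
  refine ⟨?_, inv_mem_stableSubring h1M.det_mem hne⟩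
  rw [isUnit_iff_ne_zero]
  intro h0
  refine hne 0 (by simp) ?_
  rw [h0, expansionAtInfinity_zero, psEval_zero]

theorem norm_freqResponse_le_of_hinfNorm_le {G : TransferMatrix α β} {c : ℝ} (hc : 0 ≤ c)
    (h : hinfNorm G ≤ ENNReal.ofReal c) (θ : ℝ) : ‖freqResponse G θ‖ ≤ c :=
  (ENNReal.ofReal_le_ofReal_iff hc).mp
    ((le_iSup (fun θ : ℝ => ENNReal.ofReal ‖freqResponse G θ‖) θ).trans h)

/-- The strict bound leaves a margin uniform in the frequency; small gain needs it because `‖U‖_∞`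
may equal `1/ε`. -/
theorem exists_norm_freqResponse_le_of_hinfNorm_lt {G : TransferMatrix α β} {c : ℝ}
    (h : hinfNorm G < ENNReal.ofReal c) :
    ∃ d, 0 ≤ d ∧ d < c ∧ ∀ θ, ‖freqResponse G θ‖ ≤ d := by
  have hne : hinfNorm G ≠ ⊤ := (h.trans ENNReal.ofReal_lt_top).ne
  refine ⟨(hinfNorm G).toReal, ENNReal.toReal_nonneg, ?_, fun θ => ?_⟩
  · have := (ENNReal.toReal_lt_toReal hne ENNReal.ofReal_ne_top).mpr h
    have hc : 0 ≤ c := by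
      by_contra! hc
      rw [ENNReal.ofReal_of_nonpos hc.le] at h
      exact absurd h not_lt_zero
    rwa [ENNReal.toReal_ofReal hc] at this
  · refine norm_freqResponse_le_of_hinfNorm_le ENNReal.toReal_nonneg ?_ θ
    rw [ENNReal.ofReal_toReal hne]

/-- The small gain theorem. -/
theorem small_gain {p m : ℕ} {ε : ℝ} (hε : 0 < ε) {Δ : TransferMatrix (Fin p) (Fin m)}
    (hΔ : Δ ∈ uncertaintySet p m ε) {U : TransferMatrix (Fin m) (Fin p)} (hU : IsRHinf U)
    (hn : hinfNorm U ≤ ENNReal.ofReal (1 / ε)) :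
    IsUnit (1 - Δ * U).det ∧ (1 - Δ * U).det⁻¹ ∈ stableSubring := by
  obtain ⟨d, hd0, hd, hb⟩ := exists_norm_freqResponse_le_of_hinfNorm_lt hΔ.2
  have hUb := norm_freqResponse_le_of_hinfNorm_le (by positivity) hn
  have hΔU : IsRHinf (Δ * U) := isRHinf_iff_matIn.mpr
    ((isRHinf_iff_matIn.mp hΔ.1).mul (isRHinf_iff_matIn.mp hU))
  refine inv_det_one_sub_mem hΔU (c := d * (1 / ε)) ?_ fun θ => ?_
  · rw [mul_one_div, div_lt_one hε]; exact hd
  · rw [freqResponse_mul hΔ.1 hU]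
    exact (Matrix.l2_opNorm_mul _ _).trans
      (mul_le_mul (hb θ) (hUb θ) (norm_nonneg _) hd0)

end SmallGain

/-! ### Destabilizing perturbations -/

section PhaseAlignment

/-- A nonvanishing continuous function on the circle, delayed sufficiently, is positive real
somewhere near any given point. -/
theorem exists_delay_positive {h : ℝ → ℂ} (hh : Continuous h) {θ₀ c : ℝ} (hc : 0 ≤ c)
    (h0 : c < ‖h θ₀‖) :
    ∃ (N : ℕ) (θ r : ℝ), c < r ∧ h θ * Complex.exp (-(N * (θ * Complex.I))) = r := by
  have hne : h θ₀ ≠ 0 := norm_pos_iff.mp (hc.trans_lt h0)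
  have hq : Continuous fun θ => h θ / h θ₀ := hh.div_const _
  -- Dividing by `h θ₀` keeps the values near `1`, away from the branch cut of `arg`.
  have h1 : ∀ᶠ θ in nhds θ₀, h θ / h θ₀ ∈ Complex.slitPlane := by
    refine hq.continuousAt.eventually_mem (Complex.isOpen_slitPlane.mem_nhds ?_)
    rw [div_self hne]
    exact Complex.one_mem_slitPlane
  have h2 : ∀ᶠ θ in nhds θ₀, c < ‖h θ‖ := hh.norm.continuousAt.eventually_const_lt h0
  obtain ⟨δ, hδ, hball⟩ := Metric.eventually_nhds_iff.mp (h1.and h2)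
  have hI : ∀ θ ∈ Set.Icc θ₀ (θ₀ + δ / 2), h θ / h θ₀ ∈ Complex.slitPlane ∧ c < ‖h θ‖ := by
    intro θ hθ
    refine hball ?_
    rw [Real.dist_eq, abs_of_nonneg (by linarith [hθ.1])]
    linarith [hθ.2]
  -- Over an interval of length `δ / 2` the delay turns the phase by at least `4π`, while the
  -- argument of the quotient rises by at most `2π`. The total phase `φ` thus drops by at least `2π`
  -- and meets a multiple of `2π`.
  obtain ⟨N, hN⟩ := exists_nat_ge (8 * Real.pi / δ)
  rw [div_le_iff₀ hδ] at hN
  let φ : ℝ → ℝ := fun θ => (h θ / h θ₀).arg + (h θ₀).arg - N * θ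
  have hφ : ContinuousOn φ (Set.Icc θ₀ (θ₀ + δ / 2)) := by
    refine ContinuousOn.sub (ContinuousOn.add ?_ continuousOn_const) (by fun_prop)
    exact fun θ hθ => (ContinuousAt.comp (f := fun θ => h θ / h θ₀)
      (Complex.continuousAt_arg (hI θ hθ).1) hq.continuousAt).continuousWithinAt
  have ha := Complex.neg_pi_lt_arg (h θ₀ / h θ₀)
  have hb := Complex.arg_le_pi (h (θ₀ + δ / 2) / h θ₀)
  have hpi := Real.pi_pos
  have hlen : φ (θ₀ + δ / 2) ≤ φ θ₀ - 2 * Real.pi := by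
    simp only [φ]
    nlinarith
  set k := ⌊φ θ₀ / (2 * Real.pi)⌋ with hk
  have hk1 : (k : ℝ) * (2 * Real.pi) ≤ φ θ₀ := by
    rw [← le_div_iff₀ (by positivity)]; exact Int.floor_le _
  have hk2 : φ θ₀ < (k + 1 : ℝ) * (2 * Real.pi) := by
    rw [← div_lt_iff₀ (by positivity)]; exact Int.lt_floor_add_one _
  obtain ⟨θ, hθ, hval⟩ := intermediate_value_Icc' (by linarith) hφ
    (show (k : ℝ) * (2 * Real.pi) ∈ Set.Icc (φ (θ₀ + δ / 2)) (φ θ₀) from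
      ⟨by nlinarith, hk1⟩)
  refine ⟨N, θ, ‖h θ‖, (hI θ hθ).2, ?_⟩
  have e1 := Complex.norm_mul_exp_arg_mul_I (h θ / h θ₀)
  have e2 := Complex.norm_mul_exp_arg_mul_I (h θ₀)
  have e3 : h θ = ‖h θ‖ * Complex.exp (((h θ / h θ₀).arg + (h θ₀).arg : ℝ) * Complex.I) := by
    have hne' : (‖h θ₀‖ : ℂ) ≠ 0 := by exact_mod_cast (norm_pos_iff.mpr hne).ne'
    calc h θ = (h θ / h θ₀) * h θ₀ := by rw [div_mul_cancel₀ _ hne]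
      _ = (‖h θ / h θ₀‖ * Complex.exp ((h θ / h θ₀).arg * Complex.I)) *
          (‖h θ₀‖ * Complex.exp ((h θ₀).arg * Complex.I)) := by rw [e1, e2]
      _ = _ := by
          rw [norm_div, Complex.ofReal_add, add_mul, Complex.exp_add]
          push_cast
          field_simp
  have e4 : (((h θ / h θ₀).arg + (h θ₀).arg : ℝ) * Complex.I : ℂ) - N * (θ * Complex.I) =
      k * (2 * Real.pi * Complex.I) := by
    have : (((h θ / h θ₀).arg + (h θ₀).arg - N * θ : ℝ) : ℂ) = ((k * (2 * Real.pi) : ℝ) : ℂ) :=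
      congrArg _ hval
    push_cast at this ⊢
    linear_combination Complex.I * this
  calc h θ * Complex.exp (-(N * (θ * Complex.I)))
      = ‖h θ‖ * Complex.exp ((((h θ / h θ₀).arg + (h θ₀).arg : ℝ) * Complex.I : ℂ) -
          N * (θ * Complex.I)) := by
        nth_rewrite 1 [e3]
        rw [mul_assoc, ← Complex.exp_add, sub_eq_add_neg]
    _ = ‖h θ‖ := by rw [e4, Complex.exp_int_mul_two_pi_mul_I, mul_one]

/-- Phases of the points of the orbit of an irrational rotation are dense. -/
theorem dense_rotation_phases {θ : ℝ} (hθ : Irrational (θ / (2 * Real.pi))) :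
    Dense {x : ℝ | ∃ n : ℤ, Complex.exp (x * Complex.I) =
      Complex.exp (-(n * (θ * Complex.I)))} := by
  -- The additive group generated by `θ` and `2π` is dense when their ratio is irrational; its
  -- elements are phases of delays up to full turns.
  refine (dense_addSubgroupClosure_pair_iff.mpr hθ).mono fun x hx => ?_
  obtain ⟨n, k, rfl⟩ := AddSubgroup.mem_closure_pair.mp hx
  refine ⟨-n, ?_⟩
  rw [Complex.exp_eq_exp_iff_exists_int]
  refine ⟨k, ?_⟩
  push_cast [zsmul_eq_mul]
  ring

end PhaseAlignment

section Destabilize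

open scoped Matrix.Norms.L2Operator

variable {p m : ℕ}

/-- The bilinear form `aᵀ M b`. -/
noncomputable def bilin (M : Matrix (Fin m) (Fin p) ℂ) (a : Fin m → ℂ) (b : Fin p → ℂ) : ℂ :=
  ∑ i, ∑ j, a i * M i j * b j

/-- Duality: for `a` the conjugate of `M b`, the form equals `‖M b‖²`, so a bound on all its values
would bound the operator norm. -/
theorem exists_bilin_gt {M : Matrix (Fin m) (Fin p) ℂ} {c : ℝ} (hc : 0 ≤ c) (h : c < ‖M‖) :
    ∃ (a : Fin m → ℂ) (b : Fin p → ℂ),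
      c * ‖WithLp.toLp 2 a‖ * ‖WithLp.toLp 2 b‖ < ‖bilin M a b‖ := by
  by_contra! hcon
  refine absurd (l2_opNorm_le_of_forall hc fun b => ?_) (not_le.mpr h)
  set y := M.mulVec b with hy
  have h1 := hcon (fun i => starRingEnd ℂ (y i)) b
  have h2 : ‖WithLp.toLp 2 fun i => starRingEnd ℂ (y i)‖ = ‖WithLp.toLp 2 y‖ := by
    simp [EuclideanSpace.norm_eq]
  have h3 : bilin M (fun i => starRingEnd ℂ (y i)) b = ((‖WithLp.toLp 2 y‖ ^ 2 : ℝ) : ℂ) := by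
    rw [EuclideanSpace.norm_sq_eq]
    push_cast
    refine Finset.sum_congr rfl fun i _ => ?_
    rw [← Complex.conj_mul']
    calc _ = starRingEnd ℂ (y i) * ∑ j, M i j * b j := by
          rw [Finset.mul_sum]
          exact Finset.sum_congr rfl fun j _ => by ring
      _ = _ := rfl
  rw [h2, h3, Complex.norm_real, Real.norm_of_nonneg (by positivity)] at h1
  rcases (norm_nonneg (WithLp.toLp 2 y)).eq_or_lt with h0 | h0
  · rw [← h0]; positivity
  · refine le_of_mul_le_mul_right ?_ h0
    nlinarith

theorem norm_toLp_of_norm_eq {n : ℕ} {a b : Fin n → ℂ} (h : ∀ i, ‖a i‖ = ‖b i‖) :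
    ‖WithLp.toLp 2 a‖ = ‖WithLp.toLp 2 b‖ := by
  simp [EuclideanSpace.norm_eq, h]

theorem l2_opNorm_vecMulVec_le (b : Fin p → ℂ) (a : Fin m → ℂ) :
    ‖Matrix.of fun i j => b i * a j‖ ≤ ‖WithLp.toLp 2 b‖ * ‖WithLp.toLp 2 a‖ := by
  refine l2_opNorm_le_of_forall (by positivity) fun x => ?_
  have h1 : (WithLp.toLp 2 ((Matrix.of fun i j => b i * a j).mulVec x) : EuclideanSpace ℂ (Fin p)) =
      (∑ j, a j * x j) • WithLp.toLp 2 b := by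
    ext i
    simp only [Matrix.mulVec, dotProduct, Matrix.of_apply, PiLp.smul_apply, smul_eq_mul,
      Finset.sum_mul]
    exact Finset.sum_congr rfl fun j _ => by ring
  have h2 : ‖∑ j, a j * x j‖ ≤ ‖WithLp.toLp 2 a‖ * ‖WithLp.toLp 2 x‖ := by
    have := norm_inner_le_norm (𝕜 := ℂ) (WithLp.toLp 2 fun j => starRingEnd ℂ (a j))
      (WithLp.toLp 2 x)
    rw [norm_toLp_of_norm_eq (fun j => RCLike.norm_conj (a j))] at this
    refine le_trans (le_of_eq ?_) this
    simp [PiLp.inner_apply, mul_comm]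
  rw [h1, norm_smul, mul_assoc, mul_comm]
  exact mul_le_mul_of_nonneg_left h2 (norm_nonneg _)

/-- A rank one perturbation built from real gains and pure delays. -/
noncomputable def delayPerturbation (c : ℝ) (B : Fin p → ℝ) (A : Fin m → ℝ) (n : Fin p → ℕ)
    (l : Fin m → ℕ) : TransferMatrix (Fin p) (Fin m) :=
  Matrix.of fun i j => RatFunc.C (c * B i * A j) * (RatFunc.X⁻¹) ^ (n i + l j)

theorem isRHinf_delayPerturbation (c : ℝ) (B : Fin p → ℝ) (A : Fin m → ℝ) (n : Fin p → ℕ)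
    (l : Fin m → ℕ) : IsRHinf (delayPerturbation c B A n l) :=
  isRHinf_iff.mpr fun _ _ => mul_mem (C_mem_stableSubring _) (pow_mem inv_X_mem_stableSubring _)

theorem psEval_expansion_C (c : ℝ) {x : ℂ} : psEval (expansionAtInfinity (RatFunc.C c)) x = c := by
  have : expansionAtInfinity (RatFunc.C c) = ((Polynomial.C c : Polynomial ℝ) : PowerSeries ℝ) := by
    simp [expansionAtInfinity]
  rw [this, psEval_coe]
  simp

theorem freqResponse_delayPerturbation (c : ℝ) (B : Fin p → ℝ) (A : Fin m → ℝ) (n : Fin p → ℕ)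
    (l : Fin m → ℕ) (θ : ℝ) :
    freqResponse (delayPerturbation c B A n l) θ = Matrix.of fun i j =>
      (c * B i * Complex.exp (-(n i * (θ * Complex.I)))) *
        (A j * Complex.exp (-(l j * (θ * Complex.I)))) := by
  have hz : (1 : ℝ) ≤ ‖Complex.exp (θ * Complex.I)‖ := (Complex.norm_exp_ofReal_mul_I θ).ge
  have hx := (norm_inv_exp_mul_I θ).le
  rw [← discMat_inv_exp (isRHinf_delayPerturbation c B A n l)]
  ext1 i j
  have h1 : psEval (expansionAtInfinity ((RatFunc.X : RatFunc ℝ)⁻¹))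
      (Complex.exp (θ * Complex.I))⁻¹ = (Complex.exp (θ * Complex.I))⁻¹ := by
    rw [psEval_expansion_eq_eval inv_X_mem_stableSubring hz]
    have hone : RatFunc.eval (algebraMap ℝ ℂ) (Complex.exp (θ * Complex.I))
        ((RatFunc.X : RatFunc ℝ)⁻¹ * RatFunc.X) = 1 := by
      rw [inv_mul_cancel₀ RatFunc.X_ne_zero, RatFunc.eval_one]
    have hd := inv_X_mem_stableSubring.2 _ hz
    rw [Polynomial.aeval_def] at hd
    rw [RatFunc.eval_mul _ _ hd (by simp), RatFunc.eval_X] at hone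
    exact eq_inv_of_mul_eq_one_left hone
  have h3 : psEval (expansionAtInfinity (delayPerturbation c B A n l i j))
      (Complex.exp (θ * Complex.I))⁻¹ = discEval _ hx (⟨_, C_mem_stableSubring (c * B i * A j)⟩ *
        (⟨_, inv_X_mem_stableSubring⟩ : stableSubring) ^ (n i + l j)) := by
    rw [discEval_apply]
    rfl
  rw [discMat, Matrix.of_apply, h3, map_mul, map_pow, discEval_apply, discEval_apply, h1,
    psEval_expansion_C, Matrix.of_apply, pow_add, ← Complex.exp_neg, ← Complex.exp_nat_mul,
    ← Complex.exp_nat_mul]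
  push_cast
  rw [mul_neg, mul_neg]
  ring

theorem continuous_bilin {X : Type*} [TopologicalSpace X] {M : X → Matrix (Fin m) (Fin p) ℂ}
    {a : X → Fin m → ℂ} {b : X → Fin p → ℂ} (hM : ∀ i j, Continuous fun x => M x i j)
    (ha : ∀ i, Continuous fun x => a x i) (hb : ∀ j, Continuous fun x => b x j) :
    Continuous fun x => bilin (M x) (a x) (b x) :=
  continuous_finsetSum _ fun i _ => continuous_finsetSum _ fun j _ =>
    ((ha i).mul (hM i j)).mul (hb j)

theorem bilin_mul_mul (M : Matrix (Fin m) (Fin p) ℂ) (a : Fin m → ℂ) (b : Fin p → ℂ) (s t : ℂ) :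
    bilin M (fun i => a i * s) (fun j => t * b j) = bilin M a b * (s * t) := by
  simp only [bilin, Finset.sum_mul]
  exact Finset.sum_congr rfl fun i _ => Finset.sum_congr rfl fun j _ => by ring

theorem dense_irrational_rotations : Dense {θ : ℝ | Irrational (θ / (2 * Real.pi))} := by
  have h : ((2 * Real.pi)⁻¹ : ℝ) ≠ 0 := by have := Real.pi_pos; positivity
  exact dense_irrational.preimage (Homeomorph.mulRight₀ _ h).isOpenMap

/-- If `‖U‖_∞ > 1/ε`, some unit-gain direction can be realized by real gains and delays. -/
theorem exists_delays_bilin_gt {U : TransferMatrix (Fin m) (Fin p)} (hU : IsRHinf U) {c : ℝ}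
    (hc : 0 ≤ c) (hn : ENNReal.ofReal c < hinfNorm U) :
    ∃ (A : Fin m → ℝ) (B : Fin p → ℝ) (l : Fin m → ℕ) (n : Fin p → ℕ) (θ : ℝ),
      c * ‖WithLp.toLp 2 fun i => (A i : ℂ)‖ * ‖WithLp.toLp 2 fun j => (B j : ℂ)‖ <
        ‖bilin (freqResponse U θ) (fun i => A i * Complex.exp (-(l i * (θ * Complex.I))))
          (fun j => B j * Complex.exp (-(n j * (θ * Complex.I))))‖ := by
  have hcont : ∀ i j, Continuous fun θ => freqResponse U θ i j := fun i j => by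
    simp only [freqResponse_eq_psEval hU]
    exact (absSummable_expansionAtInfinity (isRHinf_iff.mp hU i j)).continuous_psEval_circle
  obtain ⟨θ₁, hθ₁⟩ := lt_iSup_iff.mp hn
  obtain ⟨a, b, hab⟩ := exists_bilin_gt hc ((ENNReal.ofReal_lt_ofReal_iff_of_nonneg hc).mp hθ₁)
  -- The strict inequality is open in the frequency, which can therefore be moved to an irrational
  -- rotation.
  have hopen : IsOpen {θ | c * ‖WithLp.toLp 2 a‖ * ‖WithLp.toLp 2 b‖ <
      ‖bilin (freqResponse U θ) a b‖} := by
    refine isOpen_lt continuous_const (Continuous.norm ?_)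
    exact continuous_bilin hcont (fun _ => continuous_const) fun _ => continuous_const
  obtain ⟨θ, hθirr, hθ⟩ := dense_irrational_rotations.exists_mem_open hopen ⟨θ₁, hab⟩
  -- The moduli of `a` and `b` stay fixed as real gains, and their phases become free variables. The
  -- original phases satisfy the strict inequality, so nearby phases coming from integer delays do
  -- too.
  let f : (Fin m ⊕ Fin p → ℝ) → ℂ := fun x => bilin (freqResponse U θ)
    (fun i => (‖a i‖ : ℝ) * Complex.exp (x (.inl i) * Complex.I))
    (fun j => (‖b j‖ : ℝ) * Complex.exp (x (.inr j) * Complex.I))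
  have hf : Continuous f := continuous_bilin (fun _ _ => continuous_const)
    (fun i => by fun_prop) (fun j => by fun_prop)
  have hopen' : IsOpen {x | c * ‖WithLp.toLp 2 a‖ * ‖WithLp.toLp 2 b‖ < ‖f x‖} :=
    isOpen_lt continuous_const hf.norm
  have hne : {x | c * ‖WithLp.toLp 2 a‖ * ‖WithLp.toLp 2 b‖ < ‖f x‖}.Nonempty := by
    refine ⟨Sum.elim (fun i => (a i).arg) (fun j => (b j).arg), ?_⟩
    simp only [Set.mem_ofPred_eq, f, Sum.elim_inl, Sum.elim_inr, Complex.norm_mul_exp_arg_mul_I]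
    exact hθ
  obtain ⟨x, hxD, hx⟩ := (dense_pi Set.univ fun (_ : Fin m ⊕ Fin p) _ =>
    dense_rotation_phases hθirr).exists_mem_open hopen' hne
  choose k hk using fun i => hxD i (Set.mem_univ i)
  -- The integer delays may be negative. A common shift by `N` makes them all causal and changes the
  -- form only by a unimodular factor.
  set N : ℕ := ∑ i, (k i).natAbs with hN
  have hkN : ∀ i, 0 ≤ k i + N := fun i => by
    have : (k i).natAbs ≤ N :=
      Finset.single_le_sum (f := fun i => (k i).natAbs) (fun _ _ => Nat.zero_le _)
        (Finset.mem_univ i)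
    omega
  have hexp : ∀ i, Complex.exp (-(((k i + N).toNat : ℂ) * (θ * Complex.I))) =
      Complex.exp (x i * Complex.I) * Complex.exp (-(N * (θ * Complex.I))) := fun i => by
    rw [hk i, ← Complex.exp_add]
    have : (((k i + N).toNat : ℕ) : ℂ) = (k i : ℂ) + N := by
      have h1 : (((k i + N).toNat : ℕ) : ℤ) = k i + N := Int.toNat_of_nonneg (hkN i)
      exact_mod_cast congrArg (Int.cast : ℤ → ℂ) h1
    rw [this]
    congr 1
    ring
  refine ⟨fun i => ‖a i‖, fun j => ‖b j‖, fun i => (k (.inl i) + N).toNat,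
    fun j => (k (.inr j) + N).toNat, θ, ?_⟩
  rw [norm_toLp_of_norm_eq (b := a) (fun i => by simp),
    norm_toLp_of_norm_eq (b := b) (fun i => by simp)]
  refine lt_of_lt_of_eq hx ?_
  have hbil : bilin (freqResponse U θ)
      (fun i => (‖a i‖ : ℝ) * Complex.exp (-((k (.inl i) + N).toNat * (θ * Complex.I))))
      (fun j => (‖b j‖ : ℝ) * Complex.exp (-((k (.inr j) + N).toNat * (θ * Complex.I)))) =
      f x * (Complex.exp (-(N * (θ * Complex.I))) * Complex.exp (-(N * (θ * Complex.I)))) := by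
    rw [← bilin_mul_mul]
    congr 1
    · ext1 i
      rw [hexp, mul_assoc]
    · ext1 j
      rw [hexp, mul_comm (Complex.exp (-(N * (θ * Complex.I)))), mul_assoc]
  have hone : ‖Complex.exp (-(N * (θ * Complex.I)))‖ = 1 := by
    have : (-(N * (θ * Complex.I)) : ℂ) = ((-(N * θ) : ℝ) : ℂ) * Complex.I := by push_cast; ring
    rw [this, Complex.norm_exp_ofReal_mul_I]
  rw [hbil, norm_mul, norm_mul, hone, mul_one, mul_one]

/-- Necessity in the small gain theorem, with a real-rational perturbation. -/
theorem exists_destabilizing {ε : ℝ} (hε : 0 < ε) {U : TransferMatrix (Fin m) (Fin p)}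
    (hU : IsRHinf U) (hn : ENNReal.ofReal (1 / ε) < hinfNorm U) :
    ∃ Δ ∈ uncertaintySet p m ε, ∃ x : ℂ, ‖x‖ ≤ 1 ∧ (discMat (1 - Δ * U) x).det = 0 := by
  obtain ⟨A, B, l, n, θ₀, h0⟩ := exists_delays_bilin_gt hU (by positivity) hn
  set cA := ‖WithLp.toLp 2 fun i => (A i : ℂ)‖ with hcA
  set cB := ‖WithLp.toLp 2 fun j => (B j : ℂ)‖ with hcB
  have hcont : ∀ i j, Continuous fun θ => freqResponse U θ i j := fun i j => by
    simp only [freqResponse_eq_psEval hU]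
    exact (absSummable_expansionAtInfinity (isRHinf_iff.mp hU i j)).continuous_psEval_circle
  have hh : Continuous fun θ : ℝ => bilin (freqResponse U θ)
      (fun i => A i * Complex.exp (-(l i * (θ * Complex.I))))
      (fun j => B j * Complex.exp (-(n j * (θ * Complex.I)))) :=
    continuous_bilin hcont (fun i => by fun_prop) (fun j => by fun_prop)
  -- One further delay makes the form a positive real `r > cA * cB / ε` at some frequency. The gain
  -- `r⁻¹` then normalizes the form to `1` and keeps the norm of the perturbation below `ε`.
  obtain ⟨N, θ, r, hr, hval⟩ := exists_delay_positive hh (by positivity) h0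
  have hr0 : 0 < r := lt_of_le_of_lt (by positivity) hr
  set Δ := delayPerturbation r⁻¹ B A n (fun i => l i + N) with hΔ
  have hΔs : IsRHinf Δ := isRHinf_delayPerturbation _ _ _ _ _
  have hone : ∀ (k : ℕ) (θ : ℝ), ‖Complex.exp (-(k * (θ * Complex.I)))‖ = 1 := fun k θ => by
    have : (-(k * (θ * Complex.I)) : ℂ) = ((-(k * θ) : ℝ) : ℂ) * Complex.I := by push_cast; ring
    rw [this, Complex.norm_exp_ofReal_mul_I]
  have hbound : ∀ θ, ‖freqResponse Δ θ‖ ≤ r⁻¹ * (cA * cB) := fun θ => by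
    rw [hΔ, freqResponse_delayPerturbation]
    refine (l2_opNorm_vecMulVec_le _ _).trans (le_of_eq ?_)
    rw [norm_toLp_of_norm_eq (b := fun i => (A i : ℂ)) (fun i => by rw [norm_mul, hone, mul_one]),
      norm_toLp_of_norm_eq (b := ((r⁻¹ : ℝ) : ℂ) • fun i => (B i : ℂ))
        (fun i => by rw [norm_mul, hone, mul_one, Pi.smul_apply, smul_eq_mul]),
      WithLp.toLp_smul, norm_smul, Complex.norm_real, Real.norm_of_nonneg (by positivity)]
    ring
  have hlt : r⁻¹ * (cA * cB) < ε := by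
    rw [inv_mul_lt_iff₀ hr0]
    rw [mul_assoc, one_div, inv_mul_lt_iff₀ hε] at hr
    linarith
  refine ⟨Δ, ⟨hΔs, ?_⟩, (Complex.exp (θ * Complex.I))⁻¹, (norm_inv_exp_mul_I θ).le, ?_⟩
  · refine lt_of_le_of_lt (iSup_le fun θ => ENNReal.ofReal_le_ofReal (hbound θ)) ?_
    exact (ENNReal.ofReal_lt_ofReal_iff hε).mpr hlt
  · have hx := (norm_inv_exp_mul_I θ).le
    have h1s : IsRHinf (1 : TransferMatrix (Fin p) (Fin p)) := isRHinf_iff_matIn.mpr MatIn.one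
    have hΔU : IsRHinf (Δ * U) := isRHinf_iff_matIn.mpr
      ((isRHinf_iff_matIn.mp hΔs).mul (isRHinf_iff_matIn.mp hU))
    rw [discMat_sub h1s hΔU hx, discMat_one, discMat_inv_exp hΔU, freqResponse_mul hΔs hU]
    rw [← Matrix.exists_mulVec_eq_zero_iff]
    set a : Fin m → ℂ := fun j => A j * Complex.exp (-(((l j + N : ℕ) : ℂ) * (θ * Complex.I)))
      with ha
    set b : Fin p → ℂ := fun i => ((r⁻¹ : ℝ) : ℂ) * B i *
      Complex.exp (-(n i * (θ * Complex.I))) with hb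
    have hΔθ : freqResponse Δ θ = Matrix.of fun i j => b i * a j := by
      rw [hΔ, freqResponse_delayPerturbation]
    have hbil : bilin (freqResponse U θ) a b = 1 := by
      have e1 : a = fun i => (A i * Complex.exp (-(l i * (θ * Complex.I)))) *
          Complex.exp (-(N * (θ * Complex.I))) := by
        ext1 i
        have h : Complex.exp (-(((l i + N : ℕ) : ℂ) * (θ * Complex.I))) =
            Complex.exp (-(l i * (θ * Complex.I))) * Complex.exp (-(N * (θ * Complex.I))) := by
          rw [← Complex.exp_add]
          congr 1
          push_cast
          ring
        exact (congrArg (_ * ·) h).trans (mul_assoc _ _ _).symm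
      have e2 : b = fun j => ((r⁻¹ : ℝ) : ℂ) * (B j * Complex.exp (-(n j * (θ * Complex.I)))) := by
        ext1 j
        exact mul_assoc _ _ _
      rw [e1, e2, bilin_mul_mul, ← mul_assoc, hval, ← Complex.ofReal_mul,
        mul_inv_cancel₀ hr0.ne', Complex.ofReal_one]
    -- As `Δ = b aᵀ` at this frequency and `aᵀ U b = 1`, the vector `b` is nonzero and fixed by `Δ
    -- U`.
    refine ⟨b, ?_, ?_⟩
    · intro hb0
      rw [hb0] at hbil
      simp [bilin] at hbil
    · rw [Matrix.sub_mulVec, Matrix.one_mulVec, ← Matrix.mulVec_mulVec, sub_eq_zero, hΔθ]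
      ext1 i
      have : (Matrix.of fun i j => b i * a j).mulVec ((freqResponse U θ).mulVec b) i =
          b i * bilin (freqResponse U θ) a b := by
        simp only [Matrix.mulVec, dotProduct, Matrix.of_apply, bilin, Finset.mul_sum]
        exact Finset.sum_congr rfl fun j _ => Finset.sum_congr rfl fun k _ => by ring
      rw [this, hbil, mul_one]

end Destabilize

/-! ### The input-output parameterization of controllers -/

section Parameterization

variable {p m : ℕ} {Ghat Δ : TransferMatrix (Fin p) (Fin m)} {x : Responses p m}

theorem left_achievable_iff :
    Matrix.fromCols 1 (-Ghat) * x.block = Matrix.fromCols 1 0 ↔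
      x.Y - Ghat * x.U = 1 ∧ x.W - Ghat * x.Z = 0 := by
  have h : Matrix.fromCols 1 (-Ghat) * x.block =
      Matrix.fromCols ((1 : TransferMatrix (Fin p) (Fin p)) * x.Y + -Ghat * x.U)
        ((1 : TransferMatrix (Fin p) (Fin p)) * x.W + -Ghat * x.Z) :=
    Matrix.fromCols_mul_fromBlocks _ _ _ _ _ _
  rw [h]
  simp only [Matrix.one_mul, Matrix.neg_mul, ← sub_eq_add_neg]
  exact ⟨fun h => Matrix.fromCols_inj h, fun h => by rw [h.1, h.2]⟩

theorem right_achievable_iff :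
    x.block * Matrix.fromRows (-Ghat) 1 = Matrix.fromRows 0 1 ↔
      x.W - x.Y * Ghat = 0 ∧ x.Z - x.U * Ghat = 1 := by
  have h : x.block * Matrix.fromRows (-Ghat) 1 =
      Matrix.fromRows (x.Y * -Ghat + x.W * (1 : TransferMatrix (Fin m) (Fin m)))
        (x.U * -Ghat + x.Z * (1 : TransferMatrix (Fin m) (Fin m))) :=
    Matrix.fromBlocks_mul_fromRows _ _ _ _ _ _
  rw [h]
  simp only [Matrix.mul_one, Matrix.mul_neg, neg_add_eq_sub]
  exact ⟨fun h => Matrix.fromRows_inj h, fun h => by rw [h.1, h.2]⟩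

/-- The closed loop of `U Y⁻¹` on a perturbed plant. -/
theorem closedLoop_perturbed (h1 : x.Y - Ghat * x.U = 1) (h2 : x.Z - x.U * Ghat = 1)
    (hY : IsUnit x.Y.det) (hΔ : IsUnit (1 - Δ * x.U).det) :
    IsUnit (1 - (Ghat + Δ) * x.controller).det ∧
      closedLoop (Ghat + Δ) x.controller = perturbedResponses Ghat Δ x := by
  set K := x.controller with hK
  have hYY : x.Y * x.Y⁻¹ = 1 := Matrix.mul_nonsing_inv _ hY
  have hYY' : x.Y⁻¹ * x.Y = 1 := Matrix.nonsing_inv_mul _ hY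
  have hGK : Ghat * K = 1 - x.Y⁻¹ := by
    have : Ghat * x.U = x.Y - 1 := by rw [← h1]; abel
    rw [hK, Responses.controller, ← Matrix.mul_assoc, this, Matrix.sub_mul, hYY, Matrix.one_mul]
  have hΔK : Δ * K = Δ * x.U * x.Y⁻¹ := by rw [hK, Responses.controller, Matrix.mul_assoc]
  -- The nominal loop enters only through `Y⁻¹`, the perturbation only through `I - ΔU`.
  have hfac : 1 - (Ghat + Δ) * K = (1 - Δ * x.U) * x.Y⁻¹ := by
    rw [Matrix.add_mul, hGK, hΔK, Matrix.sub_mul, Matrix.one_mul]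
    abel
  have hinv : (1 - (Ghat + Δ) * K)⁻¹ = x.Y * (1 - Δ * x.U)⁻¹ := by
    rw [hfac, Matrix.mul_inv_rev, Matrix.nonsing_inv_nonsing_inv _ hY]
  have hΔ' : IsUnit (1 - x.U * Δ).det := isUnit_det_comm.mpr hΔ
  have hZK : x.Z * K = x.U := by
    have hZ : x.Z = 1 + x.U * Ghat := by rw [← h2]; abel
    rw [hZ, Matrix.add_mul, Matrix.one_mul, Matrix.mul_assoc, hGK, Matrix.mul_sub, Matrix.mul_one,
      hK, Responses.controller]
    abel
  -- This exhibits a left inverse of `I - K(Ĝ + Δ)` directly, without an inverse of `Z`.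
  have hZfac : x.Z * (1 - K * (Ghat + Δ)) = 1 - x.U * Δ := by
    rw [Matrix.mul_sub, Matrix.mul_one, ← Matrix.mul_assoc, hZK, Matrix.mul_add, ← h2]
    abel
  refine ⟨?_, ?_⟩
  · rw [hfac, Matrix.det_mul]
    exact hΔ.mul (Matrix.isUnit_nonsing_inv_det _ hY)
  · ext1
    · exact hinv
    · change (1 - (Ghat + Δ) * K)⁻¹ * (Ghat + Δ) = x.Y * (1 - Δ * x.U)⁻¹ * (Ghat + Δ)
      rw [hinv]
    · change K * (1 - (Ghat + Δ) * K)⁻¹ = x.U * (1 - Δ * x.U)⁻¹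
      rw [hinv, hK, Responses.controller, Matrix.mul_assoc, ← Matrix.mul_assoc x.Y⁻¹, hYY',
        Matrix.one_mul]
    · change (1 - K * (Ghat + Δ))⁻¹ = (1 - x.U * Δ)⁻¹ * x.Z
      refine Matrix.inv_eq_left_inv ?_
      rw [Matrix.mul_assoc, hZfac, Matrix.nonsing_inv_mul _ hΔ']

/-- Makes the nominal closed loop the case `Δ = 0` of the perturbed one. -/
theorem perturbedResponses_zero (h : x.W - x.Y * Ghat = 0) :
    perturbedResponses Ghat 0 x = x := by
  ext1
  · simp [perturbedResponses]
  · simp [perturbedResponses, (sub_eq_zero.mp h).symm]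
  · simp [perturbedResponses]
  · simp [perturbedResponses]

theorem closedLoop_controller (h1 : x.Y - Ghat * x.U = 1) (h2 : x.Z - x.U * Ghat = 1)
    (h3 : x.W - x.Y * Ghat = 0) (hY : IsUnit x.Y.det) :
    IsUnit (1 - Ghat * x.controller).det ∧ closedLoop Ghat x.controller = x := by
  have := closedLoop_perturbed (Δ := 0) h1 h2 hY (by simp)
  rwa [add_zero, perturbedResponses_zero h3] at this

theorem isRHinf_perturbedResponses {ε : ℝ} (hGhat : IsRHinf Ghat) (hx : IOPConstraints Ghat ε x)
    (hΔ : IsRHinf Δ) (hd : (1 - Δ * x.U).det⁻¹ ∈ stableSubring) :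
    IsRHinf (perturbedResponses Ghat Δ x).block := by
  have hG := isRHinf_iff_matIn.mp hGhat
  have hY := isRHinf_iff_matIn.mp hx.stable_Y
  have hU := isRHinf_iff_matIn.mp hx.stable_U
  have hZ := isRHinf_iff_matIn.mp hx.stable_Z
  have hD := isRHinf_iff_matIn.mp hΔ
  have hA : MatIn stableSubring (1 - Δ * x.U)⁻¹ := (MatIn.one.sub (hD.mul hU)).inv hd
  have hB : MatIn stableSubring (1 - x.U * Δ)⁻¹ := (MatIn.one.sub (hU.mul hD)).inv (by
    rwa [Matrix.det_one_sub_mul_comm])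
  exact isRHinf_iff_matIn.mpr ((hY.mul hA).fromBlocks ((hY.mul hA).mul (hG.add hD))
    (hU.mul hA) (hB.mul hZ))

theorem isProper_controller {ε : ℝ} (hx : x ∈ iopFeasible Ghat ε) : IsProper x.controller :=
  MatIn.mul (S := properSubring) hx.1.stable_U.1 hx.2.2

theorem IOPConstraints.equations {ε : ℝ} (hx : IOPConstraints Ghat ε x) :
    x.Y - Ghat * x.U = 1 ∧ x.W - Ghat * x.Z = 0 ∧ x.W - x.Y * Ghat = 0 ∧
      x.Z - x.U * Ghat = 1 :=
  ⟨(left_achievable_iff.mp hx.left_achievable).1, (left_achievable_iff.mp hx.left_achievable).2,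
    (right_achievable_iff.mp hx.right_achievable).1,
    (right_achievable_iff.mp hx.right_achievable).2⟩

/-- Feasible responses give robustly stabilizing controllers. -/
theorem robustly_stabilizes_of_feasible {ε : ℝ} (hε : 0 < ε) (hGhat : IsRHinf Ghat)
    (hx : x ∈ iopFeasible Ghat ε) (hΔ : Δ ∈ uncertaintySet p m ε) :
    IsUnit (1 - Δ * x.U).det ∧ closedLoop (Ghat + Δ) x.controller = perturbedResponses Ghat Δ x ∧
      InternallyStabilizes (Ghat + Δ) x.controller := by
  obtain ⟨h1, -, -, h4⟩ := hx.1.equations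
  obtain ⟨hu, hd⟩ := small_gain hε hΔ hx.1.stable_U hx.1.norm_U
  obtain ⟨ha, hb⟩ := closedLoop_perturbed h1 h4 hx.2.1 hu
  refine ⟨hu, hb, ha, ?_⟩
  rw [hb]
  exact isRHinf_perturbedResponses hGhat hx.1 hΔ.1 hd

open scoped Matrix.Norms.L2Operator in
theorem zero_mem_uncertaintySet {ε : ℝ} (hε : 0 < ε) : 0 ∈ uncertaintySet p m ε := by
  have hz : IsRHinf (0 : TransferMatrix (Fin p) (Fin m)) := isRHinf_iff_matIn.mpr MatIn.zero
  refine ⟨hz, lt_of_le_of_lt (iSup_le fun θ => ?_) (ENNReal.ofReal_pos.mpr hε)⟩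
  have : freqResponse (0 : TransferMatrix (Fin p) (Fin m)) θ = 0 := by
    ext1 i j
    simp [freqResponse]
  rw [this]
  simp

variable {K : TransferMatrix (Fin m) (Fin p)}

theorem closedLoop_equations (h : IsUnit (1 - Ghat * K).det) :
    (closedLoop Ghat K).Y - Ghat * (closedLoop Ghat K).U = 1 ∧
    (closedLoop Ghat K).W - Ghat * (closedLoop Ghat K).Z = 0 ∧
    (closedLoop Ghat K).W - (closedLoop Ghat K).Y * Ghat = 0 ∧
    (closedLoop Ghat K).Z - (closedLoop Ghat K).U * Ghat = 1 := by
  have e1 := loopMatrix_mul_block h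
  have e2 := mul_eq_one_comm.mp e1
  rw [loopMatrix, Responses.block, Matrix.fromBlocks_multiply, ← Matrix.fromBlocks_one,
    Matrix.fromBlocks_inj] at e1 e2
  simp only [Matrix.one_mul, Matrix.mul_one, Matrix.neg_mul, Matrix.mul_neg, ← sub_eq_add_neg,
    neg_add_eq_sub] at e1 e2
  exact ⟨e1.1, e1.2.1, e2.2.1, e2.2.2.2⟩

theorem controller_closedLoop (h : IsUnit (1 - Ghat * K).det) :
    (closedLoop Ghat K).controller = K := by
  change K * (1 - Ghat * K)⁻¹ * (1 - Ghat * K)⁻¹⁻¹ = K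
  rw [Matrix.nonsing_inv_nonsing_inv _ h, Matrix.mul_assoc, Matrix.nonsing_inv_mul _ h,
    Matrix.mul_one]

/-- Robustly stabilizing controllers come from feasible responses. -/
theorem closedLoop_mem_iopFeasible {ε : ℝ} (hε : 0 < ε) (hGhat : IsRHinf Ghat)
    (hK : IsProper K) (h : ∀ Δ ∈ uncertaintySet p m ε, InternallyStabilizes (Ghat + Δ) K) :
    closedLoop Ghat K ∈ iopFeasible Ghat ε ∧ (closedLoop Ghat K).controller = K := by
  obtain ⟨hd, hst⟩ := h 0 (zero_mem_uncertaintySet hε)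
  rw [add_zero] at hd hst
  have hctrl := controller_closedLoop hd
  obtain ⟨h1, h2, h3, h4⟩ := closedLoop_equations hd
  have hYdet : IsUnit (closedLoop Ghat K).Y.det := Matrix.isUnit_nonsing_inv_det _ hd
  have hYinv : (closedLoop Ghat K).Y⁻¹ = 1 - Ghat * K := Matrix.nonsing_inv_nonsing_inv _ hd
  have hYp : IsProper (closedLoop Ghat K).Y⁻¹ := by
    rw [hYinv]
    exact MatIn.sub (S := properSubring) MatIn.one (MatIn.mul hGhat.1 hK)
  obtain ⟨sY, sW, sU, sZ⟩ := matIn_fromBlocks_iff.mp (isRHinf_iff_matIn.mp hst)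
  set x := closedLoop Ghat K with hx
  refine ⟨⟨⟨left_achievable_iff.mpr ⟨h1, h2⟩, right_achievable_iff.mpr ⟨h3, h4⟩,
    isRHinf_iff_matIn.mpr sY, isRHinf_iff_matIn.mpr sW, isRHinf_iff_matIn.mpr sU,
    isRHinf_iff_matIn.mpr sZ, ?_⟩, hYdet, hYp⟩, hctrl⟩
  -- If the norm bound fails, some admissible `Δ` makes `I - ΔU` singular at a point of the closed
  -- disc, although it is still invertible as a rational matrix by stability of the loop with `Δ`.
  by_contra! hn
  obtain ⟨Δ, hΔ, z, hz, hdet⟩ := exists_destabilizing hε (isRHinf_iff_matIn.mpr sU) hn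
  obtain ⟨hdΔ, hstΔ⟩ := h Δ hΔ
  have hD := isRHinf_iff_matIn.mp hΔ.1
  have hu : IsUnit (1 - Δ * x.U).det := by
    have hfac : 1 - (Ghat + Δ) * K = (1 - Δ * x.U) * (1 - Ghat * K) := by
      have hUK : x.U * (1 - Ghat * K) = K := by
        change K * (1 - Ghat * K)⁻¹ * (1 - Ghat * K) = K
        rw [Matrix.mul_assoc, Matrix.nonsing_inv_mul _ hd, Matrix.mul_one]
      rw [Matrix.sub_mul, Matrix.one_mul, Matrix.mul_assoc, hUK, Matrix.add_mul]
      abel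
    rw [hfac, Matrix.det_mul] at hdΔ
    exact isUnit_of_mul_isUnit_left hdΔ
  obtain ⟨-, hcl⟩ := closedLoop_perturbed h1 h4 hYdet hu
  rw [hctrl] at hcl
  rw [hcl] at hstΔ
  obtain ⟨-, -, hUΔ, -⟩ := matIn_fromBlocks_iff.mp (isRHinf_iff_matIn.mp hstΔ)
  change MatIn stableSubring (x.U * (1 - Δ * x.U)⁻¹) at hUΔ
  have hA : MatIn stableSubring (1 - Δ * x.U) := MatIn.one.sub (hD.mul sU)
  have hAA : (1 - Δ * x.U) * (1 - Δ * x.U)⁻¹ = 1 := Matrix.mul_nonsing_inv _ hu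
  -- Stability of the perturbed response `U(I - ΔU)⁻¹` alone makes `(I - ΔU)⁻¹ = I + ΔU(I - ΔU)⁻¹`
  -- stable. Its value at the singular point would then invert a singular matrix.
  have hAi : MatIn stableSubring (1 - Δ * x.U)⁻¹ := by
    have e : (1 - Δ * x.U)⁻¹ = 1 + Δ * (x.U * (1 - Δ * x.U)⁻¹) := by
      rw [Matrix.sub_mul, Matrix.one_mul, sub_eq_iff_eq_add, Matrix.mul_assoc] at hAA
      exact hAA
    rw [e]
    exact MatIn.one.add (hD.mul hUΔ)
  have hone := congrArg (discMat · z) hAA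
  simp only [discMat_mul (isRHinf_iff_matIn.mpr hA) (isRHinf_iff_matIn.mpr hAi) hz,
    discMat_one] at hone
  have := congrArg Matrix.det hone
  rw [Matrix.det_mul, hdet, zero_mul, Matrix.det_one] at this
  exact zero_ne_one this

/-- For strictly proper nominal plants, `Y` has a proper inverse. -/
theorem isUnit_det_of_strictlyProper {ε : ℝ} (hG : IsStrictlyProper Ghat)
    (hx : IOPConstraints Ghat ε x) : IsUnit x.Y.det ∧ IsProper x.Y⁻¹ := by
  have hGp : IsProper Ghat := fun i j => (hG i j).le
  have hGU : IsProper (Ghat * x.U) := MatIn.mul (S := properSubring) hGp hx.stable_U.1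
  have hY : x.Y = 1 - -(Ghat * x.U) := by
    rw [← hx.equations.1]; abel
  -- At `z = ∞` the plant vanishes, so `Y = I + ĜU` takes the value `I` there.
  have hconst : (expandMat x.Y).map PowerSeries.constantCoeff = 1 := by
    have h0 : (expandMat (Ghat * x.U)).map (PowerSeries.constantCoeff (R := ℝ)) = 0 := by
      rw [expandMat_mul hGp hx.stable_U.1, Matrix.map_mul]
      have : (expandMat Ghat).map (PowerSeries.constantCoeff (R := ℝ)) = 0 := by
        ext1 i j
        exact constantCoeff_eq_zero_of_strictlyProper (hG i j)
      rw [this, Matrix.zero_mul]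
    ext1 i j
    have e : x.Y i j = (1 : TransferMatrix (Fin p) (Fin p)) i j + (Ghat * x.U) i j := by
      rw [hY]; simp
    have e0 := congrFun (congrFun h0 i) j
    have e1 := congrFun (congrFun (expandMat_one (α := Fin p)) i) j
    rw [expandMat, Matrix.map_apply] at e1
    rw [expandMat, Matrix.map_apply, Matrix.map_apply] at e0
    rw [expandMat, Matrix.map_apply, Matrix.map_apply, e,
      expansionAtInfinity_add (MatIn.one i j) (hGU i j), map_add, e0, e1, Matrix.zero_apply,
      add_zero, Matrix.one_apply, Matrix.one_apply]
    split_ifs <;> simp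
  have hc : PowerSeries.constantCoeff (expansionAtInfinity x.Y.det) ≠ 0 := by
    rw [← det_expandMat hx.stable_Y.1, RingHom.map_det]
    change ((expandMat x.Y).map PowerSeries.constantCoeff).det ≠ 0
    rw [hconst, Matrix.det_one]
    exact one_ne_zero
  refine ⟨?_, MatIn.inv (S := properSubring) hx.stable_Y.1 (inv_mem_properSubring hc)⟩
  rw [isUnit_iff_ne_zero]
  intro h0
  rw [h0, expansionAtInfinity_zero, map_zero] at hc
  exact hc rfl

/-! ### The zero controller has bounded worst-case cost -/

theorem closedLoop_zero (G : TransferMatrix (Fin p) (Fin m)) :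
    (closedLoop G 0).block = Matrix.fromBlocks 1 G 0 1 := by
  simp [closedLoop, Responses.block]

theorem internallyStabilizes_zero {G : TransferMatrix (Fin p) (Fin m)} (hG : IsRHinf G) :
    InternallyStabilizes G 0 := by
  refine ⟨by simp, ?_⟩
  rw [closedLoop_zero]
  exact isRHinf_iff_matIn.mpr
    (MatIn.one.fromBlocks (isRHinf_iff_matIn.mp hG) MatIn.zero MatIn.one)

theorem h2Norm_le_of_norm_entry_le {α β : Type} [Fintype α] [Fintype β]
    {G : TransferMatrix α β} {c : ℝ} (h : ∀ θ i j, ‖freqResponse G θ i j‖ ≤ c) :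
    h2Norm G ≤ (ENNReal.ofReal (1 / (2 * Real.pi)) *
      ∫⁻ _ in Set.Icc (-Real.pi) Real.pi,
        ENNReal.ofReal (∑ _i : α, ∑ _j : β, c ^ 2)) ^ (1 / 2 : ℝ) := by
  refine ENNReal.rpow_le_rpow (mul_le_mul_right ?_ _) (by norm_num)
  refine MeasureTheory.lintegral_mono fun θ => ENNReal.ofReal_le_ofReal ?_
  exact Finset.sum_le_sum fun i _ => Finset.sum_le_sum fun j _ =>
    pow_le_pow_left₀ (norm_nonneg _) (h θ i j) 2

theorem exists_bound_freqResponse {α β : Type} [Fintype α] [Fintype β]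
    {G : TransferMatrix α β} (hG : IsRHinf G) :
    ∃ c : ℝ, 0 ≤ c ∧ ∀ θ i j, ‖freqResponse G θ i j‖ ≤ c := by
  have habs := fun i j => absSummable_expansionAtInfinity (isRHinf_iff.mp hG i j)
  have h0 : ∀ i j, 0 ≤ ∑' k, ‖PowerSeries.coeff k (expansionAtInfinity (G i j))‖ :=
    fun i j => tsum_nonneg fun _ => norm_nonneg _
  refine ⟨∑ i, ∑ j, ∑' k, ‖PowerSeries.coeff k (expansionAtInfinity (G i j))‖,
    Finset.sum_nonneg fun i _ => Finset.sum_nonneg fun j _ => h0 i j, fun θ i j => ?_⟩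
  have hx := norm_inv_exp_mul_I θ
  have h1 : ‖freqResponse G θ i j‖ ≤
      ∑' k, ‖PowerSeries.coeff k (expansionAtInfinity (G i j))‖ := by
    rw [freqResponse_eq_psEval hG]
    have := norm_tsum_le_tsum_norm ((habs i j).psSummable hx.le)
    simpa only [norm_mul, norm_pow, hx, one_pow, mul_one, Complex.norm_real] using! this
  refine h1.trans ((Finset.single_le_sum (f := fun j =>
    ∑' k, ‖PowerSeries.coeff k (expansionAtInfinity (G i j))‖) (fun j _ => h0 i j)
    (Finset.mem_univ j)).trans ?_)
  exact Finset.single_le_sum (f := fun i => ∑ j,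
    ∑' k, ‖PowerSeries.coeff k (expansionAtInfinity (G i j))‖)
    (fun i _ => Finset.sum_nonneg fun j _ => h0 i j) (Finset.mem_univ i)

open scoped Matrix.Norms.L2Operator in
/-- The `H_2` norms of the open loops are uniformly bounded over the uncertainty set. -/
theorem exists_h2Norm_closedLoop_zero_le {ε : ℝ} (hε : 0 < ε) (hGhat : IsRHinf Ghat) :
    ∃ C : ℝ≥0∞, C < ⊤ ∧ ∀ Δ ∈ uncertaintySet p m ε,
      h2Norm (closedLoop (Ghat + Δ) 0).block ≤ C := by
  obtain ⟨c, hc, hb⟩ := exists_bound_freqResponse hGhat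
  -- In the constant, `1` covers the identity blocks, `c` the nominal plant and `ε` the
  -- perturbation.
  refine ⟨_, ?_, fun Δ hΔ => h2Norm_le_of_norm_entry_le (c := 1 + c + ε) fun θ i j => ?_⟩
  · refine ENNReal.rpow_lt_top_of_nonneg (by norm_num) (ENNReal.mul_ne_top ENNReal.ofReal_ne_top ?_)
    rw [MeasureTheory.setLIntegral_const]
    exact ENNReal.mul_ne_top ENNReal.ofReal_ne_top (by simp)
  · have hone : ∀ {n : ℕ} (i j : Fin n),
        ‖RatFunc.eval (algebraMap ℝ ℂ) (Complex.exp (θ * Complex.I))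
          ((1 : TransferMatrix (Fin n) (Fin n)) i j)‖ ≤ 1 := by
      intro n i j
      rw [Matrix.one_apply]
      split_ifs
      · rw [RatFunc.eval_one, norm_one]
      · rw [RatFunc.eval_zero, norm_zero]; exact zero_le_one
    rw [closedLoop_zero]
    rcases i with i | i <;> rcases j with j | j
    · exact (hone i j).trans (by linarith)
    · change ‖freqResponse (Ghat + Δ) θ i j‖ ≤ _
      have hGΔ : IsRHinf (Ghat + Δ) := isRHinf_iff_matIn.mpr
        ((isRHinf_iff_matIn.mp hGhat).add (isRHinf_iff_matIn.mp hΔ.1))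
      rw [← discMat_inv_exp hGΔ, discMat_add hGhat hΔ.1 (norm_inv_exp_mul_I θ).le,
        discMat_inv_exp hGhat, discMat_inv_exp hΔ.1, Matrix.add_apply]
      have h1 := norm_entry_le_l2_opNorm (freqResponse Δ θ) i j
      have h2 := norm_freqResponse_le_of_hinfNorm_le hε.le hΔ.2.le θ
      have h3 := norm_add_le (freqResponse Ghat θ i j) (freqResponse Δ θ i j)
      have h4 := hb θ i j
      linarith
    · change ‖RatFunc.eval (algebraMap ℝ ℂ) (Complex.exp (θ * Complex.I)) (0 : RatFunc ℝ)‖ ≤ _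
      rw [RatFunc.eval_zero, norm_zero]
      positivity
    · exact (hone i j).trans (by linarith)

end Parameterization

/-! ### Worst-case costs -/

section WorstCase

open MeasureTheory

variable {p m : ℕ} {Ω : Type*} [MeasurableSpace Ω] {P : Measure Ω} [IsProbabilityMeasure P]
  {v : ℕ → Ω → Fin p → ℝ} {w : ℕ → Ω → Fin m → ℝ} {Ghat : TransferMatrix (Fin p) (Fin m)} {ε : ℝ}

theorem isProper_add_uncertainty (hGhat : IsRHinf Ghat) {Δ : TransferMatrix (Fin p) (Fin m)}
    (hΔ : Δ ∈ uncertaintySet p m ε) : IsProper (Ghat + Δ) :=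
  MatIn.add (S := properSubring) hGhat.1 hΔ.1.1

theorem robust_cost_lt_top_iff (hvw : IsWhiteNoise P v w) (hGhat : IsRHinf Ghat)
    {K : TransferMatrix (Fin m) (Fin p)} (hK : IsProper K) :
    (∀ Δ ∈ uncertaintySet p m ε, lqgCost P v w (Ghat + Δ) K < ⊤) ↔
      ∀ Δ ∈ uncertaintySet p m ε, InternallyStabilizes (Ghat + Δ) K :=
  forall₂_congr fun _ hΔ => lqgCost_lt_top_iff hvw (isProper_add_uncertainty hGhat hΔ) hK

theorem lqgCost_feasible (hvw : IsWhiteNoise P v w) (hGhat : IsRHinf Ghat) (hε : 0 < ε)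
    {x : Responses p m} (hx : x ∈ iopFeasible Ghat ε) {Δ : TransferMatrix (Fin p) (Fin m)}
    (hΔ : Δ ∈ uncertaintySet p m ε) :
    lqgCost P v w (Ghat + Δ) x.controller = h2Norm (perturbedResponses Ghat Δ x).block ^ 2 := by
  obtain ⟨-, hcl, hst⟩ := robustly_stabilizes_of_feasible hε hGhat hx hΔ
  rw [lqgCost_of_internallyStabilizes hvw (isProper_add_uncertainty hGhat hΔ)
    (isProper_controller hx) hst, hcl]

/-- The costs agree for each `Δ`, and squaring commutes with suprema in `[0, ∞]`. -/
theorem worstCaseCost_feasible (hvw : IsWhiteNoise P v w) (hGhat : IsRHinf Ghat) (hε : 0 < ε)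
    {x : Responses p m} (hx : x ∈ iopFeasible Ghat ε) :
    worstCaseCost P v w Ghat ε x.controller = iopObjective Ghat ε x ^ 2 := by
  rw [iopObjective, ENNReal.iSup_pow_of_ne_zero two_ne_zero]
  refine iSup_congr fun Δ => ?_
  rw [ENNReal.iSup_pow_of_ne_zero two_ne_zero]
  exact iSup_congr fun hΔ => lqgCost_feasible hvw hGhat hε hx hΔ

theorem exists_feasible_of_robust_cost_lt_top (hvw : IsWhiteNoise P v w) (hGhat : IsRHinf Ghat)
    (hε : 0 < ε) {K : TransferMatrix (Fin m) (Fin p)} (hK : IsProper K)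
    (h : ∀ Δ ∈ uncertaintySet p m ε, lqgCost P v w (Ghat + Δ) K < ⊤) :
    ∃ x ∈ iopFeasible Ghat ε, x.controller = K :=
  ⟨_, closedLoop_mem_iopFeasible hε hGhat hK ((robust_cost_lt_top_iff hvw hGhat hK).mp h)⟩

theorem exists_feasible_of_worstCaseCost_lt_top (hvw : IsWhiteNoise P v w)
    (hGhat : IsRHinf Ghat) (hε : 0 < ε) {K : TransferMatrix (Fin m) (Fin p)} (hK : IsProper K)
    (h : worstCaseCost P v w Ghat ε K < ⊤) : ∃ x ∈ iopFeasible Ghat ε, x.controller = K :=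
  exists_feasible_of_robust_cost_lt_top hvw hGhat hε hK fun Δ hΔ =>
    (le_iSup₂ (f := fun Δ (_ : Δ ∈ uncertaintySet p m ε) => lqgCost P v w (Ghat + Δ) K)
      Δ hΔ).trans_lt h

theorem isProper_zero : IsProper (0 : TransferMatrix (Fin m) (Fin p)) :=
  MatIn.zero (S := properSubring)

/-- Without feedback the loop is stable and its `H₂` norm is bounded uniformly in `Δ`. This makes
the optimal value finite and forces every minimizer to have finite cost. -/
theorem worstCaseCost_zero_lt_top (hvw : IsWhiteNoise P v w) (hGhat : IsRHinf Ghat)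
    (hε : 0 < ε) : worstCaseCost P v w Ghat ε 0 < ⊤ := by
  obtain ⟨C, hC, hb⟩ := exists_h2Norm_closedLoop_zero_le hε hGhat
  refine lt_of_le_of_lt (iSup₂_le fun Δ hΔ => ?_) (ENNReal.pow_lt_top hC (n := 2))
  have hGΔ : IsRHinf (Ghat + Δ) := isRHinf_iff_matIn.mpr
    ((isRHinf_iff_matIn.mp hGhat).add (isRHinf_iff_matIn.mp hΔ.1))
  rw [lqgCost_of_internallyStabilizes hvw hGΔ.1 isProper_zero (internallyStabilizes_zero hGΔ)]
  exact pow_le_pow_left' (hb Δ hΔ) 2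

theorem iInf_worstCaseCost_lt_top (hvw : IsWhiteNoise P v w) (hGhat : IsRHinf Ghat)
    (hε : 0 < ε) : (⨅ K ∈ {K | IsProper K}, worstCaseCost P v w Ghat ε K) < ⊤ :=
  (iInf₂_le 0 isProper_zero).trans_lt (worstCaseCost_zero_lt_top hvw hGhat hε)

theorem iInf_worstCaseCost_eq (hvw : IsWhiteNoise P v w) (hGhat : IsRHinf Ghat) (hε : 0 < ε) :
    (⨅ K ∈ {K | IsProper K}, worstCaseCost P v w Ghat ε K) =
      (⨅ x ∈ iopFeasible Ghat ε, iopObjective Ghat ε x) ^ 2 := by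
  -- As an order isomorphism, squaring passes through the infimum even when it is not attained.
  let e := ENNReal.orderIsoRpow 2 two_pos
  have he : ∀ a : ℝ≥0∞, a ^ 2 = e a := fun a => (ENNReal.rpow_two a).symm
  rw [he, e.map_iInf₂]
  simp only [← he]
  refine le_antisymm (le_iInf₂ fun x hx => ?_) (le_iInf₂ fun K hK => ?_)
  · rw [← worstCaseCost_feasible hvw hGhat hε hx]
    exact iInf₂_le x.controller (isProper_controller hx)
  · rcases eq_or_ne (worstCaseCost P v w Ghat ε K) ⊤ with htop | htop
    · rw [htop]; exact le_top
    · obtain ⟨x, hx, rfl⟩ := exists_feasible_of_worstCaseCost_lt_top hvw hGhat hε hK htop.lt_top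
      rw [worstCaseCost_feasible hvw hGhat hε hx]
      exact iInf₂_le x hx

theorem closedLoop_controller_of_feasible {x : Responses p m} (hx : x ∈ iopFeasible Ghat ε) :
    closedLoop Ghat x.controller = x := by
  obtain ⟨h1, -, h3, h4⟩ := hx.1.equations
  exact (closedLoop_controller h1 h4 h3 hx.2.1).2

/-- Feasible responses are recovered from their controller as its nominal closed loop. -/
theorem injOn_controller : Set.InjOn Responses.controller (iopFeasible Ghat ε) :=
  fun x hx y hy h => by
    rw [← closedLoop_controller_of_feasible hx, ← closedLoop_controller_of_feasible hy, h]

theorem bijOn_controller (hvw : IsWhiteNoise P v w) (hGhat : IsRHinf Ghat) (hε : 0 < ε) :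
    Set.BijOn Responses.controller (iopFeasible Ghat ε)
      {K | IsProper K ∧ ∀ Δ ∈ uncertaintySet p m ε, lqgCost P v w (Ghat + Δ) K < ⊤} := by
  refine ⟨fun x hx => ⟨isProper_controller hx, ?_⟩, injOn_controller, fun K hK => ?_⟩
  · exact (robust_cost_lt_top_iff hvw hGhat (isProper_controller hx)).mpr fun Δ hΔ =>
      (robustly_stabilizes_of_feasible hε hGhat hx hΔ).2.2
  · exact exists_feasible_of_robust_cost_lt_top hvw hGhat hε hK.1 hK.2

theorem bijOn_minimizers (hvw : IsWhiteNoise P v w) (hGhat : IsRHinf Ghat) (hε : 0 < ε) :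
    Set.BijOn Responses.controller
      {x | x ∈ iopFeasible Ghat ε ∧
        ∀ x' ∈ iopFeasible Ghat ε, iopObjective Ghat ε x ≤ iopObjective Ghat ε x'}
      {K | IsProper K ∧
        ∀ K', IsProper K' → worstCaseCost P v w Ghat ε K ≤ worstCaseCost P v w Ghat ε K'} := by
  refine ⟨fun x hx => ⟨isProper_controller hx.1, fun K' hK' => ?_⟩,
    injOn_controller.mono fun x hx => hx.1, fun K hK => ?_⟩
  · rcases eq_or_ne (worstCaseCost P v w Ghat ε K') ⊤ with htop | htop
    · rw [htop]; exact le_top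
    · obtain ⟨x', hx', rfl⟩ :=
        exists_feasible_of_worstCaseCost_lt_top hvw hGhat hε hK' htop.lt_top
      rw [worstCaseCost_feasible hvw hGhat hε hx.1, worstCaseCost_feasible hvw hGhat hε hx']
      exact (ENNReal.pow_le_pow_left_iff two_ne_zero).mpr (hx.2 x' hx')
  · have hlt := (hK.2 0 isProper_zero).trans_lt (worstCaseCost_zero_lt_top hvw hGhat hε)
    obtain ⟨x, hx, rfl⟩ := exists_feasible_of_worstCaseCost_lt_top hvw hGhat hε hK.1 hlt
    refine ⟨x, ⟨hx, fun x' hx' => ?_⟩, rfl⟩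
    have := hK.2 x'.controller (isProper_controller hx')
    rw [worstCaseCost_feasible hvw hGhat hε hx, worstCaseCost_feasible hvw hGhat hε hx'] at this
    exact (ENNReal.pow_le_pow_left_iff two_ne_zero).mp this

end WorstCase

end RobustLQG

/-! ### The equivalence theorem -/

theorem mainTheorem4 {p m : ℕ} {Ω : Type*} [MeasurableSpace Ω]
    (P : MeasureTheory.Measure Ω) [MeasureTheory.IsProbabilityMeasure P]
    (v : ℕ → Ω → Fin p → ℝ) (w : ℕ → Ω → Fin m → ℝ) (hvw : IsWhiteNoise P v w)
    (Ghat : TransferMatrix (Fin p) (Fin m)) (hGhat : IsRHinf Ghat) (ε : ℝ) (hε : 0 < ε) :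
    -- the limit defining the LQG cost exists along the closed-loop signals
    (∀ K, IsProper K → ∀ Δ ∈ uncertaintySet p m ε, WellPosed (Ghat + Δ) K →
      ∀ (y : ℕ → Ω → Fin p → ℝ) (u : ℕ → Ω → Fin m → ℝ),
        (∀ ω, LoopEq (Ghat + Δ) K (fun t => v t ω) (fun t => w t ω)
          (fun t => y t ω) (fun t => u t ω)) →
        Filter.Tendsto (avgCost P y u) Filter.atTop (nhds (lqgCost P v w (Ghat + Δ) K))) ∧
    -- finite cost for every uncertainty is the same as robust internal stability
    (∀ K, IsProper K →
      ((∀ Δ ∈ uncertaintySet p m ε, lqgCost P v w (Ghat + Δ) K < ⊤) ↔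
        ∀ Δ ∈ uncertaintySet p m ε, InternallyStabilizes (Ghat + Δ) K)) ∧
    -- feasible responses correspond bijectively to these controllers through `K = U Y⁻¹`,
    -- and they are the closed-loop responses of `K` on the nominal plant
    Set.BijOn Responses.controller (iopFeasible Ghat ε)
      {K | IsProper K ∧ ∀ Δ ∈ uncertaintySet p m ε, lqgCost P v w (Ghat + Δ) K < ⊤} ∧
    (∀ x ∈ iopFeasible Ghat ε, closedLoop Ghat x.controller = x) ∧
    -- the cost on every perturbed plant
    (∀ x ∈ iopFeasible Ghat ε, ∀ Δ ∈ uncertaintySet p m ε,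
      IsUnit (1 - Δ * x.U).det ∧ IsUnit (1 - x.U * Δ).det ∧
      closedLoop (Ghat + Δ) x.controller = perturbedResponses Ghat Δ x ∧
      IsRHinf (perturbedResponses Ghat Δ x).block ∧
      lqgCost P v w (Ghat + Δ) x.controller =
        h2Norm (perturbedResponses Ghat Δ x).block ^ 2) ∧
    -- the optimal values agree, and are finite
    (⨅ K ∈ {K | IsProper K}, worstCaseCost P v w Ghat ε K) =
      (⨅ x ∈ iopFeasible Ghat ε, iopObjective Ghat ε x) ^ 2 ∧
    (⨅ K ∈ {K | IsProper K}, worstCaseCost P v w Ghat ε K) < ⊤ ∧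
    -- optimal responses correspond to optimal controllers through `K = U Y⁻¹`
    Set.BijOn Responses.controller
      {x | x ∈ iopFeasible Ghat ε ∧
        ∀ x' ∈ iopFeasible Ghat ε, iopObjective Ghat ε x ≤ iopObjective Ghat ε x'}
      {K | IsProper K ∧
        ∀ K', IsProper K' → worstCaseCost P v w Ghat ε K ≤ worstCaseCost P v w Ghat ε K'} ∧
    -- for strictly proper nominal plants the constraints alone describe the feasible set
    (IsStrictlyProper Ghat → iopFeasible Ghat ε = {x | IOPConstraints Ghat ε x}) := by
  refine ⟨fun K hK Δ hΔ hw y u h => ?_, fun K hK => robust_cost_lt_top_iff hvw hGhat hK,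
    bijOn_controller hvw hGhat hε, fun x hx => closedLoop_controller_of_feasible hx,
    fun x hx Δ hΔ => ?_, iInf_worstCaseCost_eq hvw hGhat hε,
    iInf_worstCaseCost_lt_top hvw hGhat hε, bijOn_minimizers hvw hGhat hε, fun hsp => ?_⟩
  · have hG := isProper_add_uncertainty hGhat hΔ
    rw [lqgCost_eq_tsum hvw hG hK hw]
    exact tendsto_avgCost hvw hG hK hw h
  · obtain ⟨hu, hcl, hst⟩ := robustly_stabilizes_of_feasible hε hGhat hx hΔ
    exact ⟨hu, isUnit_det_comm.mpr hu, hcl, hcl ▸ hst.2, lqgCost_feasible hvw hGhat hε hx hΔ⟩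
  · exact Set.ext fun x => ⟨fun hx => hx.1, fun hx => ⟨hx, isUnit_det_of_strictlyProper hsp hx⟩⟩
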